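/- Let $m\ge 1$, $n\ge 1$ and let $\mathbb G=(\mathbb R^m\times\mathbb R^n,\circ,\delta_r)$ be a homogeneous Lie group, i.e. a smooth group law with identity $0$ for which the dilations $\delta_r(x_1,x_2)=(rx_1,r^2x_2)$, $r>0$, are automorphisms. Suppose that its Lie algebra $\mathfrak g$, with center $\mathfrak z$, is of H-type with respect to an inner product $\langle\cdot,\cdot\rangle$: $[\mathfrak z^\perp,\mathfrak z^\perp]=\mathfrak z$, and for every $z\in\mathfrak z$ with $\langle z,z\rangle=1$ the map $J_z:\mathfrak z^\perp\to\mathfrak z^\perp$ defined by $\langle J_z(v),w\rangle=\langle z,[v,w]\rangle$ for all $w\in\mathfrak z^\perp$ is orthogonal. Let $X_1,\dots,X_m$ be an orthonormal basis of $\mathfrak z^\perp$, regarded as left-invariant vector fields. Write $x=\mathrm{Exp}(v(x)+z(x))$ with $v(x)\in\mathfrak z^\perp$ and $z(x)\in\mathfrak z$, and put $$d(x)=\left(\|v(x)\|^4+16\|z(x)\|^2\right)^{1/4},\qquad B_1(0)=\{x: d(x)<1\},\qquad Q=m+2n .$$ Let $0<\delta\le 2$ and $\alpha=Q-\delta$.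 Then there is a constant $C>0$, depending only on $\delta$, $d$ and the fields $X_j$, such that the following holds for every open set $O\subseteq B_1(0)$. For $\varepsilon>0$ let $\eta_\varepsilon\in C^\infty([0,\infty))$ be any function with $0\le\eta_\varepsilon\le1$, $\eta_\varepsilon(\rho)=0$ for $0\le\rho<\varepsilon$ and $\eta_\varepsilon(\rho)=1$ for $\rho\ge2\varepsilon$. The functions $$h(x)=-\frac1\alpha\int_O d(x^{-1}\circ\xi)^{-\alpha}\,d\xi,\qquad h_\varepsilon(x)=-\frac1\alpha\int_O\frac{\eta_\varepsilon(d(x^{-1}\circ\xi))}{d(x^{-1}\circ\xi)^{\alpha}}\,d\xi$$ are well defined on $\mathbb G$ (the integrals converge absolutely), $h_\varepsilon\in C^\infty(\mathbb G)$, and $h_\varepsilon\to h$ uniformly on $\mathbb G$ as $\varepsilon\to0^+$. Moreover, let $0<\lambda\le\Lambda$, let $\Omega\subseteq\mathbb G$ be open, and let $A=(a_{ij})$ be a function on $\Omega$ whose values are symmetric $m\times m$ matrices with $\lambda\|\zeta\|^2\le\langle A(x)\zeta,\zeta\rangle\le\Lambda\|\zeta\|^2$ for all $\zeta\in\mathbb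 R^m$, $x\in\Omega$, satisfying the $\delta$-Landis condition $$\mathrm{Tr}(A(x))+(Q+2-m)\max_{\|\zeta\|=1}\langle A(x)\zeta,\zeta\rangle\le(Q+4-\delta)\min_{\|\zeta\|=1}\langle A(x)\zeta,\zeta\rangle\qquad\forall x\in\Omega.$$ Then for every compact set $O'\subset O$ with $O'\subseteq\Omega$ and every $\varepsilon>0$ with $2\varepsilon<d(O',\partial O):=\inf\{d(\xi^{-1}\circ x): x\in O',\ \xi\in\partial O\}$, $$\mathcal L_A h_\varepsilon(x)=\sum_{i,j=1}^m a_{ij}(x)X_iX_jh_\varepsilon(x)\ge C\lambda\qquad\forall x\in O'.$$ -/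

import Mathlib

open MeasureTheory Set Filter Topology
open scoped ContDiff Matrix

noncomputable section

namespace HType

/-- The underlying space `ℝ^N = ℝ^m × ℝ^n` of the group; its `volume` is Lebesgue measure. -/
abbrev Pt (m n : ℕ) : Type := (Fin m → ℝ) × (Fin n → ℝ)

/-- The dilations `δ_r (x₁, x₂) = (r x₁, r² x₂)`. -/
def dil {m n : ℕ} (r : ℝ) (x : Pt m n) : Pt m n := (r • x.1, r ^ 2 • x.2)

/-- A homogeneous Lie group `(ℝ^m × ℝ^n, ∘, δ_r)`: a smooth group law with identity `0` for which
the dilations `δ_r`, `r > 0`, are automorphisms. -/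
structure HomogeneousLieGroup (m n : ℕ) where
  mul : Pt m n → Pt m n → Pt m n
  inv : Pt m n → Pt m n
  mul_assoc : ∀ x y z, mul (mul x y) z = mul x (mul y z)
  zero_mul : ∀ x, mul 0 x = x
  mul_zero : ∀ x, mul x 0 = x
  inv_mul : ∀ x, mul (inv x) x = 0
  mul_inv : ∀ x, mul x (inv x) = 0
  contDiff_mul : ContDiff ℝ ∞ (fun p : Pt m n × Pt m n => mul p.1 p.2)
  contDiff_inv : ContDiff ℝ ∞ inv
  dil_mul : ∀ r : ℝ, 0 < r → ∀ x y, dil r (mul x y) = mul (dil r x) (dil r y)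

variable {m n : ℕ}

/-- The left-invariant vector field with value `w` at the identity. The Lie algebra `𝔤` of the group
is identified, as a vector space, with the tangent space `ℝ^N` at the identity. -/
def leftInv (G : HomogeneousLieGroup m n) (w : Pt m n) (x : Pt m n) : Pt m n :=
  fderiv ℝ (fun y => G.mul x y) 0 w

/-- The bracket of `𝔤`: the commutator of left-invariant vector fields. -/
def bracket (G : HomogeneousLieGroup m n) (v w : Pt m n) : Pt m n :=
  VectorField.lieBracket ℝ (leftInv G v) (leftInv G w) 0

/-- The center `𝔷` of `𝔤`. -/
def lieCenter (G : HomogeneousLieGroup m n) : Set (Pt m n) :=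
  {z | ∀ w, bracket G z w = 0}

/-- The orthogonal complement `𝔟 = 𝔷^⊥` of the center. -/
def horizontal (G : HomogeneousLieGroup m n) (g : LinearMap.BilinForm ℝ (Pt m n)) :
    Set (Pt m n) :=
  {v | ∀ z ∈ lieCenter G, g v z = 0}

/-- `J` restricts to the map `J_z : 𝔷^⊥ → 𝔷^⊥` given by `⟨J_z v, w⟩ = ⟨z, [v, w]⟩` for all
`w ∈ 𝔷^⊥`. -/
def IsJMap (G : HomogeneousLieGroup m n) (g : LinearMap.BilinForm ℝ (Pt m n))
    (z : Pt m n) (J : Pt m n → Pt m n) : Prop :=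
  ∀ v ∈ horizontal G g, J v ∈ horizontal G g ∧
    ∀ w ∈ horizontal G g, g (J v) w = g z (bracket G v w)

/-- The inner product `g` makes the Lie algebra of `G` an H-type algebra. -/
structure IsHType (G : HomogeneousLieGroup m n) (g : LinearMap.BilinForm ℝ (Pt m n)) : Prop where
  symm : ∀ v w, g v w = g w v
  pos : ∀ v, v ≠ 0 → 0 < g v v
  bracket_horizontal :
    (Submodule.span ℝ {u | ∃ v ∈ horizontal G g, ∃ w ∈ horizontal G g, u = bracket G v w} :
      Set (Pt m n)) = lieCenter G
  orthogonal : ∀ z ∈ lieCenter G, g z z = 1 → ∃ J : Pt m n → Pt m n, IsJMap G g z J ∧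
    ∀ v ∈ horizontal G g, ∀ w ∈ horizontal G g, g (J v) (J w) = g v w

/-- `X₁, …, X_m` is a `g`-orthonormal basis of `𝔷^⊥`. -/
structure IsHorizontalBasis (G : HomogeneousLieGroup m n) (g : LinearMap.BilinForm ℝ (Pt m n))
    (X : Fin m → Pt m n) : Prop where
  orthonormal : ∀ i j, g (X i) (X j) = if i = j then 1 else 0
  span : (Submodule.span ℝ (range X) : Set (Pt m n)) = horizontal G g

/-- `x = Exp w`: the integral curve of the left-invariant field of `w` issued from the identity is
at `x` at time one. -/
def IsExp (G : HomogeneousLieGroup m n) (w x : Pt m n) : Prop :=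
  ∃ γ : ℝ → Pt m n, γ 0 = 0 ∧ (∀ t, HasDerivAt γ (leftInv G w (γ t)) t) ∧ γ 1 = x

/-- The inverse `Log` of the exponential map. -/
def logMap (G : HomogeneousLieGroup m n) (x : Pt m n) : Pt m n :=
  Classical.epsilon (fun w => IsExp G w x)

/-- The component `v(x)` of `Log x` in `𝔷^⊥`. -/
def vPart (G : HomogeneousLieGroup m n) (g : LinearMap.BilinForm ℝ (Pt m n))
    (X : Fin m → Pt m n) (x : Pt m n) : Pt m n :=
  ∑ j, g (logMap G x) (X j) • X j

/-- The component `z(x)` of `Log x` in `𝔷`. -/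
def zPart (G : HomogeneousLieGroup m n) (g : LinearMap.BilinForm ℝ (Pt m n))
    (X : Fin m → Pt m n) (x : Pt m n) : Pt m n :=
  logMap G x - vPart G g X x

/-- The gauge `d(x) = (‖v(x)‖⁴ + 16 ‖z(x)‖²)^(1/4)`. -/
def gaugeNorm (G : HomogeneousLieGroup m n) (g : LinearMap.BilinForm ℝ (Pt m n))
    (X : Fin m → Pt m n) (x : Pt m n) : ℝ :=
  (g (vPart G g X x) (vPart G g X x) ^ 2 + 16 * g (zPart G g X x) (zPart G g X x)) ^ (1 / 4 : ℝ)

/-- The gauge ball `B_R(0)`. -/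
def gaugeBall (G : HomogeneousLieGroup m n) (g : LinearMap.BilinForm ℝ (Pt m n))
    (X : Fin m → Pt m n) (R : ℝ) : Set (Pt m n) :=
  {x | gaugeNorm G g X x < R}

/-- `inf {d(ξ⁻¹ ∘ x) : x ∈ S, ξ ∈ T}`. -/
def gaugeDist (G : HomogeneousLieGroup m n) (g : LinearMap.BilinForm ℝ (Pt m n))
    (X : Fin m → Pt m n) (S T : Set (Pt m n)) : ℝ :=
  sInf {r | ∃ x ∈ S, ∃ ξ ∈ T, r = gaugeNorm G g X (G.mul (G.inv ξ) x)}

/-- The derivative of `f` along the left-invariant field of `w`. -/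
def along (G : HomogeneousLieGroup m n) (w : Pt m n) (f : Pt m n → ℝ) (x : Pt m n) : ℝ :=
  fderiv ℝ f x (leftInv G w x)

/-- The operator `L_A = ∑ a_{ij}(x) X_i X_j`. -/
def opL (G : HomogeneousLieGroup m n) (X : Fin m → Pt m n)
    (A : Pt m n → Matrix (Fin m) (Fin m) ℝ) (f : Pt m n → ℝ) (x : Pt m n) : ℝ :=
  ∑ i, ∑ j, A x i j * along G (X i) (along G (X j) f) x

/-- The symmetric `m × m` matrices `M` with `lam ‖ξ‖² ≤ ⟨M ξ, ξ⟩ ≤ Lam ‖ξ‖²`. -/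
def IsElliptic (lam Lam : ℝ) (M : Matrix (Fin m) (Fin m) ℝ) : Prop :=
  M.IsSymm ∧ ∀ ξ : Fin m → ℝ,
    lam * (ξ ⬝ᵥ ξ) ≤ (M *ᵥ ξ) ⬝ᵥ ξ ∧ (M *ᵥ ξ) ⬝ᵥ ξ ≤ Lam * (ξ ⬝ᵥ ξ)

/-- The values of the quadratic form of `M` on the Euclidean unit sphere. -/
def sphereValues (M : Matrix (Fin m) (Fin m) ℝ) : Set ℝ :=
  {r | ∃ ξ : Fin m → ℝ, ξ ⬝ᵥ ξ = 1 ∧ r = (M *ᵥ ξ) ⬝ᵥ ξ}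

/-- The homogeneous dimension `Q = m + 2n`. -/
def homDim (m n : ℕ) : ℝ := (m : ℝ) + 2 * (n : ℝ)

/-- The `δ`-Landis condition at one point, `n` being the dimension of the center. -/
def Landis (n : ℕ) (δ : ℝ) (M : Matrix (Fin m) (Fin m) ℝ) : Prop :=
  M.trace + (homDim m n + 2 - (m : ℝ)) * sSup (sphereValues M) ≤
    (homDim m n + 4 - δ) * sInf (sphereValues M)

/-- The admissible cut-off functions `η_ε ∈ C^∞([0, ∞))`. -/
structure IsCutoff (ε : ℝ) (η : ℝ → ℝ) : Prop where
  smooth : ContDiffOn ℝ ∞ η (Ici 0)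
  nonneg : ∀ ρ, 0 ≤ ρ → 0 ≤ η ρ
  le_one : ∀ ρ, 0 ≤ ρ → η ρ ≤ 1
  eq_zero : ∀ ρ, 0 ≤ ρ → ρ < ε → η ρ = 0
  eq_one : ∀ ρ, 2 * ε ≤ ρ → η ρ = 1

/-- The kernel `ξ ↦ d(x⁻¹ ∘ ξ)^{-α}`. -/
def kernel (G : HomogeneousLieGroup m n) (g : LinearMap.BilinForm ℝ (Pt m n))
    (X : Fin m → Pt m n) (α : ℝ) (x ξ : Pt m n) : ℝ :=
  gaugeNorm G g X (G.mul (G.inv x) ξ) ^ (-α)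

/-- The truncated kernel `ξ ↦ η(d(x⁻¹ ∘ ξ)) d(x⁻¹ ∘ ξ)^{-α}`. -/
def cutKernel (G : HomogeneousLieGroup m n) (g : LinearMap.BilinForm ℝ (Pt m n))
    (X : Fin m → Pt m n) (α : ℝ) (η : ℝ → ℝ) (x ξ : Pt m n) : ℝ :=
  η (gaugeNorm G g X (G.mul (G.inv x) ξ)) * kernel G g X α x ξ

/-- `h(x) = -(1/α) ∫_O d(x⁻¹ ∘ ξ)^{-α} dξ`. -/
def barrier (G : HomogeneousLieGroup m n) (g : LinearMap.BilinForm ℝ (Pt m n))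
    (X : Fin m → Pt m n) (α : ℝ) (O : Set (Pt m n)) (x : Pt m n) : ℝ :=
  -(1 / α) * ∫ ξ in O, kernel G g X α x ξ

/-- `h_ε(x) = -(1/α) ∫_O η_ε(d(x⁻¹ ∘ ξ)) d(x⁻¹ ∘ ξ)^{-α} dξ`, with `η = η_ε`. -/
def cutBarrier (G : HomogeneousLieGroup m n) (g : LinearMap.BilinForm ℝ (Pt m n))
    (X : Fin m → Pt m n) (α : ℝ) (η : ℝ → ℝ) (O : Set (Pt m n)) (x : Pt m n) : ℝ :=
  -(1 / α) * ∫ ξ in O, cutKernel G g X α η x ξ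

end HType

end

/-! In exponential coordinates the group law is `x + y + b(x, y)` with `b` bilinear on the first
layer, so the Lie bracket, the exponential map and the gauge are explicit polynomials. With
`N = d⁴`, H-type means that the fields `X_i` see `N` through `∑ (X_i N)² = 16 ‖v‖² N`, and the
Landis condition then gives `L_A d^{-α} ≥ 0` away from the singularity.

For `x, ξ ∈ O ⊆ B_1(0)` the distance `d(ξ⁻¹ ∘ x)` is bounded, so beyond some radius the kernel
`η_ε(d) d^{-α}` may be bent into a constant without changing `h_ε` on `O`. Subtracting this constant
leaves a smooth compactly supported `Φ` for which `∫_G Φ(ξ⁻¹ ∘ x) dξ` does not depend on `x`; hence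
on `O`, up to a constant, `h_ε` is `1/α` times the integral of `Φ(ξ⁻¹ ∘ x)` over the complement
of `O`. For `x ∈ O'` only points with `d(ξ⁻¹ ∘ x) > 2ε` occur there, where `L_A Φ ≥ 0`, and the
shell on which the kernel is bent, whose translate to `x` never meets `O`, contributes `C λ`. -/

noncomputable section

namespace HType

section Homogeneous

variable {E F : Type*} [NormedAddCommGroup E] [NormedSpace ℝ E] [NormedAddCommGroup F]
  [NormedSpace ℝ F] {f : E → F} {a b : E} {c : F}

theorem hasDerivAt_parabola (a b : E) (r : ℝ) :
    HasDerivAt (fun r : ℝ => r • a + r ^ 2 • b) (a + (2 * r) • b) r := by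
  simpa using ((hasDerivAt_id r).smul_const a).fun_add ((hasDerivAt_pow 2 r).smul_const b)

theorem hasDerivAt_comp_parabola (hf : Differentiable ℝ f) (a b : E) (r : ℝ) :
    HasDerivAt (fun r : ℝ => f (r • a + r ^ 2 • b))
      (fderiv ℝ f (r • a + r ^ 2 • b) (a + (2 * r) • b)) r :=
  (hf _).hasFDerivAt.comp_hasDerivAt r (hasDerivAt_parabola a b r)

theorem eq_fderiv_of_homogeneous (hf : ContDiff ℝ 1 f)
    (h : ∀ r : ℝ, 0 < r → f (r • a + r ^ 2 • b) = r • c) : c = fderiv ℝ f 0 a := by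
  have hderiv : EqOn (fun r : ℝ => fderiv ℝ f (r • a + r ^ 2 • b) (a + (2 * r) • b))
      (fun _ => c) (Ioi 0) := fun r hr => by
    have hlin : HasDerivAt (fun r : ℝ => r • c) c r := by
      simpa using (hasDerivAt_id r).smul_const c
    refine (hasDerivAt_comp_parabola (hf.differentiable one_ne_zero) a b r).unique
      (hlin.congr_of_eventuallyEq ?_)
    filter_upwards [Ioi_mem_nhds hr] with s hs using h s hs
  have hcont : Continuous fun r : ℝ => fderiv ℝ f (r • a + r ^ 2 • b) (a + (2 * r) • b) :=
    ((hf.continuous_fderiv one_ne_zero).comp (by fun_prop)).clm_apply (by fun_prop)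
  simpa using (hderiv.closure hcont continuous_const (by simp : (0 : ℝ) ∈ closure (Ioi 0))).symm

theorem two_smul_eq_of_homogeneous (hf : ContDiff ℝ 2 f)
    (h : ∀ r : ℝ, 0 < r → f (r • a + r ^ 2 • b) = r ^ 2 • c) :
    (2 : ℝ) • c = fderiv ℝ (fderiv ℝ f) 0 a a + (2 : ℝ) • fderiv ℝ f 0 b := by
  set φ : ℝ → F := fun r => fderiv ℝ f (r • a + r ^ 2 • b) (a + (2 * r) • b) with hφ
  have hf' : ContDiff ℝ 1 (fderiv ℝ f) := hf.fderiv_right (by norm_num)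
  have hderiv : EqOn φ (fun r => (2 * r) • c) (Ioi 0) := fun r hr => by
    have hsq : HasDerivAt (fun r : ℝ => r ^ 2 • c) ((2 * r) • c) r := by
      simpa using (hasDerivAt_pow 2 r).smul_const c
    refine (hasDerivAt_comp_parabola (hf.differentiable two_ne_zero) a b r).unique
      (hsq.congr_of_eventuallyEq ?_)
    filter_upwards [Ioi_mem_nhds hr] with s hs using h s hs
  have hcont : Continuous φ := (hf'.continuous.comp (by fun_prop)).clm_apply (by fun_prop)
  have hφ0 : HasDerivAt φ (fderiv ℝ (fderiv ℝ f) 0 a a + (2 : ℝ) • fderiv ℝ f 0 b) 0 := by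
    have hvel : HasDerivAt (fun r : ℝ => a + (2 * r) • b) ((2 : ℝ) • b) 0 := by
      simpa using (((hasDerivAt_id (0 : ℝ)).const_mul 2).smul_const b).const_add a
    simpa [hφ] using
      (hasDerivAt_comp_parabola (hf'.differentiable one_ne_zero) a b 0).clm_apply hvel
  have hlin : HasDerivWithinAt φ ((2 : ℝ) • c) (Ici 0) 0 := by
    have h2c : HasDerivAt (fun r : ℝ => (2 * r) • c) ((2 : ℝ) • c) 0 := by
      simpa using ((hasDerivAt_id (0 : ℝ)).const_mul 2).smul_const c
    have hEq : EqOn φ (fun r => (2 * r) • c) (Ici 0) := by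
      simpa using hderiv.closure hcont (by fun_prop)
    exact h2c.hasDerivWithinAt.congr hEq (hEq self_mem_Ici)
  exact (uniqueDiffOn_Ici (0 : ℝ) 0 self_mem_Ici).eq_deriv _ hlin hφ0.hasDerivWithinAt

end Homogeneous

variable {m n : ℕ}

section GroupLaw

variable (G : HomogeneousLieGroup m n)

theorem parabola_eq_dil (r : ℝ) (p : Pt m n × Pt m n) :
    r • (((p.1.1, 0), (p.2.1, 0)) : Pt m n × Pt m n) + r ^ 2 • ((0, p.1.2), (0, p.2.2)) =
      (dil r p.1, dil r p.2) := by
  simp [dil]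

theorem mul_fst (x y : Pt m n) : (G.mul x y).1 = x.1 + y.1 := by
  set f : Pt m n × Pt m n → (Fin m → ℝ) := fun p => (G.mul p.1 p.2).1 with hf
  have hlin : ∀ p, f p = fderiv ℝ f 0 ((p.1.1, 0), (p.2.1, 0)) := fun p => by
    refine eq_fderiv_of_homogeneous (b := ((0, p.1.2), (0, p.2.2)))
      ((contDiff_fst.comp G.contDiff_mul).of_le (by norm_cast)) fun r hr => ?_
    rw [parabola_eq_dil]
    exact congrArg Prod.fst (G.dil_mul r hr p.1 p.2).symm
  have hadd : f (x, y) = f (x, 0) + f (0, y) := by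
    rw [hlin (x, y), hlin (x, 0), hlin (0, y), ← map_add]
    simp
  simpa [hf, G.mul_zero, G.zero_mul] using hadd

/-- The bilinear part of the group law in the second layer, as a mixed second derivative. -/
def cocycle : (Fin m → ℝ) →L[ℝ] (Fin m → ℝ) →L[ℝ] (Fin n → ℝ) :=
  (fderiv ℝ (fderiv ℝ fun p : Pt m n × Pt m n => (G.mul p.1 p.2).2) 0).bilinearComp
    ((ContinuousLinearMap.inl ℝ (Pt m n) (Pt m n)).comp (ContinuousLinearMap.inl ℝ _ _))
    ((ContinuousLinearMap.inr ℝ (Pt m n) (Pt m n)).comp (ContinuousLinearMap.inl ℝ _ _))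

theorem mul_snd (x y : Pt m n) : (G.mul x y).2 = x.2 + y.2 + cocycle G x.1 y.1 := by
  set f : Pt m n × Pt m n → (Fin n → ℝ) := fun p => (G.mul p.1 p.2).2 with hf
  have hfs : ContDiff ℝ 2 f := (contDiff_snd.comp G.contDiff_mul).of_le (by norm_cast)
  set B := fderiv ℝ (fderiv ℝ f) 0
  have htaylor : ∀ p, (2 : ℝ) • f p =
      B ((p.1.1, 0), (p.2.1, 0)) ((p.1.1, 0), (p.2.1, 0)) +
        (2 : ℝ) • fderiv ℝ f 0 ((0, p.1.2), (0, p.2.2)) := fun p => by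
    refine two_smul_eq_of_homogeneous hfs fun r hr => ?_
    rw [parabola_eq_dil]
    exact congrArg Prod.snd (G.dil_mul r hr p.1 p.2).symm
  have hsymm : B ((0, 0), (y.1, 0)) ((x.1, 0), (0, 0)) = B ((x.1, 0), (0, 0)) ((0, 0), (y.1, 0)) :=
    hfs.contDiffAt.isSymmSndFDerivAt (by simp) _ _
  have hadd : (2 : ℝ) • f (x, y) = (2 : ℝ) • (f (x, 0) + f (0, y) + cocycle G x.1 y.1) := by
    have hfst : (((x.1, 0), (y.1, 0)) : Pt m n × Pt m n) =
        ((x.1, 0), (0, 0)) + ((0, 0), (y.1, 0)) := by simp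
    have hsnd : (((0, x.2), (0, y.2)) : Pt m n × Pt m n) =
        ((0, x.2), (0, 0)) + ((0, 0), (0, y.2)) := by simp
    have hcocycle : cocycle G x.1 y.1 = B ((x.1, 0), (0, 0)) ((0, 0), (y.1, 0)) := rfl
    rw [smul_add, smul_add, htaylor (x, y), htaylor (x, 0), htaylor (0, y), hfst, hsnd, hcocycle]
    simp only [map_add, add_apply, hsymm, Prod.fst_zero, Prod.snd_zero]
    module
  simpa [hf, G.mul_zero, G.zero_mul] using smul_right_injective _ (two_ne_zero (α := ℝ)) hadd

/-- The bilinear part of the group law, as a map with values in the second layer of `ℝ^N`. -/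
def twist : Pt m n →L[ℝ] Pt m n →L[ℝ] Pt m n :=
  (ContinuousLinearMap.compL ℝ (Pt m n) (Fin n → ℝ) (Pt m n) (ContinuousLinearMap.inr ℝ _ _)).comp
    ((cocycle G).bilinearComp (ContinuousLinearMap.fst ℝ _ _) (ContinuousLinearMap.fst ℝ _ _))

theorem twist_apply (x y : Pt m n) : twist G x y = (0, cocycle G x.1 y.1) := by
  simp [twist]

theorem twist_twist_left (x y w : Pt m n) : twist G (twist G x y) w = 0 := by
  simp [twist_apply]

theorem twist_twist_right (x y w : Pt m n) : twist G w (twist G x y) = 0 := by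
  simp [twist_apply]

theorem mul_eq (x y : Pt m n) : G.mul x y = x + y + twist G x y := by
  ext1 <;> simp [twist_apply, mul_fst, mul_snd]

theorem inv_eq (x : Pt m n) : G.inv x = -x + twist G x x := by
  have hright : G.mul x (-x + twist G x x) = 0 := by
    simp [mul_eq, twist_twist_right]
  rw [← G.mul_zero (G.inv x), ← hright, ← G.mul_assoc, G.inv_mul, G.zero_mul]

theorem leftInv_eq (w x : Pt m n) : leftInv G w x = w + twist G x w := by
  have hmul : HasFDerivAt (fun y => G.mul x y)
      (ContinuousLinearMap.id ℝ (Pt m n) + twist G x) 0 := by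
    simp_rw [mul_eq]
    exact ((hasFDerivAt_id (𝕜 := ℝ) (0 : Pt m n)).const_add x).add (twist G x).hasFDerivAt
  simp [leftInv, hmul.fderiv]

theorem hasFDerivAt_leftInv (w x : Pt m n) : HasFDerivAt (leftInv G w) ((twist G).flip w) x := by
  rw [show leftInv G w = fun x => w + (twist G).flip w x from funext fun x => leftInv_eq G w x]
  exact ((twist G).flip w).hasFDerivAt.const_add w

end GroupLaw

section Exponential

variable (G : HomogeneousLieGroup m n)

theorem hasDerivAt_parabola_leftInv (w : Pt m n) (t : ℝ) :
    HasDerivAt (fun t : ℝ => t • w + t ^ 2 • (1 / 2 : ℝ) • twist G w w)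
      (leftInv G w (t • w + t ^ 2 • (1 / 2 : ℝ) • twist G w w)) t := by
  refine (hasDerivAt_parabola w ((1 / 2 : ℝ) • twist G w w) t).congr_deriv ?_
  simp only [leftInv_eq, map_add, map_smul, add_apply, smul_apply, twist_twist_left]
  module

theorem eq_parabola_of_hasDerivAt_leftInv {w : Pt m n} {γ : ℝ → Pt m n} (h0 : γ 0 = 0)
    (hγ : ∀ t, HasDerivAt γ (leftInv G w (γ t)) t) (t : ℝ) :
    γ t = t • w + t ^ 2 • (1 / 2 : ℝ) • twist G w w := by
  set σ : ℝ → Pt m n := fun t => t • w + t ^ 2 • (1 / 2 : ℝ) • twist G w w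
  have hdiff : ∀ t, HasDerivAt (fun t => γ t - σ t) (twist G (γ t - σ t) w) t := fun t => by
    refine ((hγ t).fun_sub (hasDerivAt_parabola_leftInv G w t)).congr_deriv ?_
    simp only [leftInv_eq, map_sub, sub_apply, add_sub_add_left_eq_sub, σ]
  have hfst : ∀ t, (γ t - σ t).1 = 0 := fun t => by
    have hd : ∀ t, HasDerivAt (fun t => (γ t - σ t).1) 0 t := fun t => by
      have := (hasFDerivAt_fst (𝕜 := ℝ) (p := γ t - σ t)).comp_hasDerivAt t (hdiff t)
      rwa [twist_apply] at this
    simpa [h0, σ] using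
      is_const_of_deriv_eq_zero (fun t => (hd t).differentiableAt) (fun t => (hd t).deriv) t 0
  have hd : ∀ t, HasDerivAt (fun t => γ t - σ t) 0 t := fun t => by
    simpa only [twist_apply, hfst, map_zero, zero_apply, ← Prod.zero_eq_mk] using hdiff t
  simpa [h0, σ, sub_eq_zero] using
    is_const_of_deriv_eq_zero (fun t => (hd t).differentiableAt) (fun t => (hd t).deriv) t 0

theorem isExp_iff (w x : Pt m n) : IsExp G w x ↔ x = w + (1 / 2 : ℝ) • twist G w w := by
  constructor
  · rintro ⟨γ, h0, hγ, rfl⟩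
    simpa using eq_parabola_of_hasDerivAt_leftInv G h0 hγ 1
  · rintro rfl
    exact ⟨_, by simp, hasDerivAt_parabola_leftInv G w, by simp⟩

theorem logMap_eq (x : Pt m n) : logMap G x = x - (1 / 2 : ℝ) • twist G x x := by
  have hexp : IsExp G (x - (1 / 2 : ℝ) • twist G x x) x := by
    simp [isExp_iff, twist_twist_left, twist_twist_right]
  have hlog := (isExp_iff G _ _).1 (Classical.epsilon_spec (p := fun w => IsExp G w x) ⟨_, hexp⟩)
  change x = logMap G x + (1 / 2 : ℝ) • twist G (logMap G x) (logMap G x) at hlog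
  generalize logMap G x = u at hlog ⊢
  simp [hlog, twist_twist_left, twist_twist_right]

end Exponential

section Bracket

variable (G : HomogeneousLieGroup m n)

/-- The bracket of the Lie algebra as a continuous bilinear map. -/
def bracketL : Pt m n →L[ℝ] Pt m n →L[ℝ] Pt m n :=
  twist G - (twist G).flip

theorem bracketL_apply (v w : Pt m n) : bracketL G v w = twist G v w - twist G w v := rfl

theorem bracket_eq_bracketL (v w : Pt m n) : bracket G v w = bracketL G v w := by
  rw [bracket, VectorField.lieBracket, (hasFDerivAt_leftInv G w 0).fderiv,
    (hasFDerivAt_leftInv G v 0).fderiv]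
  simp [leftInv_eq, bracketL_apply]

theorem bracketL_fst (v w : Pt m n) : (bracketL G v w).1 = 0 := by
  simp [bracketL_apply, twist_apply]

theorem bracketL_swap (v w : Pt m n) : bracketL G v w = -bracketL G w v := by
  simp [bracketL_apply]

theorem bracketL_self (v : Pt m n) : bracketL G v v = 0 := by
  simp [bracketL_apply]

variable {G}

theorem bracketL_of_fst_eq_zero {z : Pt m n} (hz : z.1 = 0) (w : Pt m n) :
    bracketL G z w = 0 := by
  simp [bracketL_apply, twist_apply, hz]

theorem mem_lieCenter_of_fst_eq_zero {z : Pt m n} (hz : z.1 = 0) : z ∈ lieCenter G := fun w => by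
  rw [bracket_eq_bracketL, bracketL_of_fst_eq_zero hz]

end Bracket

section BilinearAlgebra

open Module

theorem exists_orthonormal_family {V : Type*} [AddCommGroup V] [Module ℝ V] [FiniteDimensional ℝ V]
    {B : LinearMap.BilinForm ℝ V} (symm : ∀ v w, B v w = B w v) (pos : ∀ v, v ≠ 0 → 0 < B v v)
    {k : ℕ} (hk : finrank ℝ V = k) :
    ∃ e : Fin k → V, (∀ i, B (e i) (e i) = 1) ∧ ∀ u w, B u w = ∑ i, B (e i) u * B (e i) w := by
  subst hk
  let core : InnerProductSpace.Core ℝ V :=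
    { inner := fun v w => B v w
      conj_inner_symm := fun v w => symm w v
      re_inner_nonneg := fun v => by
        rcases eq_or_ne v 0 with rfl | hv
        · simp
        · exact (pos v hv).le
      add_left := fun u v w => by simp
      smul_left := fun u v r => by simp
      definite := fun v hv => by_contra fun h => (pos v h).ne' hv }
  let _ : NormedAddCommGroup V := core.toNormedAddCommGroup
  let _ : InnerProductSpace ℝ V := InnerProductSpace.ofCore core.toCore
  let e := stdOrthonormalBasis ℝ V
  refine ⟨e, fun i => inner_self_eq_one_of_norm_eq_one (𝕜 := ℝ) (e.norm_eq_one i), fun u w => ?_⟩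
  simp only [symm (e _) u]
  exact (e.sum_inner_mul_inner u w).symm

theorem mulVec_dotProduct_eq_sum {ι : Type*} [Fintype ι] (A : Matrix ι ι ℝ) (u : ι → ℝ) :
    (A *ᵥ u) ⬝ᵥ u = ∑ i, ∑ j, A i j * (u i * u j) := by
  simp only [dotProduct, Matrix.mulVec, Finset.sum_mul]
  exact Finset.sum_congr rfl fun i _ => Finset.sum_congr rfl fun j _ => by ring

theorem sum_mul_eq_zero_of_isSymm {ι : Type*} [Fintype ι] {A : Matrix ι ι ℝ} (hA : A.IsSymm)
    {B : ι → ι → ℝ} (hB : ∀ i j, B i j = -B j i) : ∑ i, ∑ j, A i j * B i j = 0 := by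
  have hneg : ∑ i, ∑ j, A i j * B i j = -∑ i, ∑ j, A i j * B i j := by
    conv_lhs => rw [Finset.sum_comm]
    simp only [← Finset.sum_neg_distrib]
    refine Finset.sum_congr rfl fun i _ => Finset.sum_congr rfl fun j _ => ?_
    rw [hB j i, hA.apply, mul_neg]
  exact self_eq_neg.1 hneg

theorem exists_mem_sphereValues (A : Matrix (Fin m) (Fin m) ℝ) {u : Fin m → ℝ} (hu : u ≠ 0) :
    ∃ r ∈ sphereValues A, (A *ᵥ u) ⬝ᵥ u = r * (u ⬝ᵥ u) := by
  have hpos : 0 < u ⬝ᵥ u := lt_of_le_of_ne (Finset.sum_nonneg fun i _ => mul_self_nonneg (u i))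
    fun h => hu (dotProduct_self_eq_zero.1 h.symm)
  set s := √(u ⬝ᵥ u)
  have hs : s ≠ 0 := (Real.sqrt_pos.2 hpos).ne'
  have hsq : u ⬝ᵥ u = s * s := (Real.mul_self_sqrt hpos.le).symm
  refine ⟨_, ⟨s⁻¹ • u, ?_, rfl⟩, ?_⟩ <;>
    simp only [Matrix.mulVec_smul, smul_dotProduct, dotProduct_smul, smul_eq_mul, hsq] <;>
    field_simp

theorem sInf_sphereValues_mul_le {A : Matrix (Fin m) (Fin m) ℝ} (hA : BddBelow (sphereValues A))
    (u : Fin m → ℝ) : sInf (sphereValues A) * (u ⬝ᵥ u) ≤ (A *ᵥ u) ⬝ᵥ u := by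
  rcases eq_or_ne u 0 with rfl | hu
  · simp
  obtain ⟨r, hr, hAu⟩ := exists_mem_sphereValues A hu
  rw [hAu]
  exact mul_le_mul_of_nonneg_right (csInf_le hA hr)
    (Finset.sum_nonneg fun i _ => mul_self_nonneg (u i))

theorem le_sSup_sphereValues_mul {A : Matrix (Fin m) (Fin m) ℝ} (hA : BddAbove (sphereValues A))
    (u : Fin m → ℝ) : (A *ᵥ u) ⬝ᵥ u ≤ sSup (sphereValues A) * (u ⬝ᵥ u) := by
  rcases eq_or_ne u 0 with rfl | hu
  · simp
  obtain ⟨r, hr, hAu⟩ := exists_mem_sphereValues A hu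
  rw [hAu]
  exact mul_le_mul_of_nonneg_right (le_csSup hA hr)
    (Finset.sum_nonneg fun i _ => mul_self_nonneg (u i))

theorem IsElliptic.bddBelow_sphereValues {lam Lam : ℝ} {A : Matrix (Fin m) (Fin m) ℝ}
    (hA : IsElliptic lam Lam A) : BddBelow (sphereValues A) :=
  ⟨lam, by rintro _ ⟨ξ, hξ, rfl⟩; simpa [hξ] using (hA.2 ξ).1⟩

theorem IsElliptic.bddAbove_sphereValues {lam Lam : ℝ} {A : Matrix (Fin m) (Fin m) ℝ}
    (hA : IsElliptic lam Lam A) : BddAbove (sphereValues A) :=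
  ⟨Lam, by rintro _ ⟨ξ, hξ, rfl⟩; simpa [hξ] using (hA.2 ξ).2⟩

end BilinearAlgebra

variable {G : HomogeneousLieGroup m n} {g : LinearMap.BilinForm ℝ (Pt m n)} {X : Fin m → Pt m n}

section HorizontalFrame

theorem IsHType.inner_self_nonneg (hG : IsHType G g) (v : Pt m n) : 0 ≤ g v v := by
  rcases eq_or_ne v 0 with rfl | h
  · simp
  · exact (hG.pos v h).le

theorem IsHType.horizontal_dim_pos (hG : IsHType G g) (hn : 0 < n) : 0 < m := by
  rcases Nat.eq_zero_or_pos m with rfl | hm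
  · have hcenter : ((0, fun _ => 1) : Pt 0 n) ∈ lieCenter G := mem_lieCenter_of_fst_eq_zero rfl
    have hbracket : ∀ u ∈ {u | ∃ v ∈ horizontal G g, ∃ w ∈ horizontal G g, u = bracket G v w},
        u = 0 := by
      rintro _ ⟨v, -, w, -, rfl⟩
      rw [bracket_eq_bracketL, bracketL_of_fst_eq_zero (Subsingleton.elim _ _)]
    rw [← hG.bracket_horizontal, Submodule.span_eq_bot.2 hbracket] at hcenter
    simpa using congrFun (congrArg Prod.snd ((Submodule.mem_bot ℝ).1 hcenter)) ⟨0, hn⟩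
  · exact hm

namespace IsHorizontalBasis

theorem sum_mem_horizontal (hX : IsHorizontalBasis G g X) (c : Fin m → ℝ) :
    ∑ j, c j • X j ∈ horizontal G g := by
  rw [← hX.span]
  exact Submodule.sum_mem _ fun j _ => Submodule.smul_mem _ _ (Submodule.subset_span ⟨j, rfl⟩)

theorem mem_horizontal (hX : IsHorizontalBasis G g X) (j : Fin m) : X j ∈ horizontal G g := by
  rw [← hX.span]
  exact Submodule.subset_span ⟨j, rfl⟩

theorem inner_eq_zero_of_fst_eq_zero (hX : IsHorizontalBasis G g X) (hG : IsHType G g)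
    {z : Pt m n} (hz : z.1 = 0) (j : Fin m) : g z (X j) = 0 := by
  rw [hG.symm]
  exact hX.mem_horizontal j z (mem_lieCenter_of_fst_eq_zero hz)

theorem inner_sum (hX : IsHorizontalBasis G g X) (c : Fin m → ℝ) (i : Fin m) :
    g (∑ j, c j • X j) (X i) = c i := by
  simp [map_sum, LinearMap.sum_apply, hX.orthonormal]

theorem inner_sum_self (hX : IsHorizontalBasis G g X) (c : Fin m → ℝ) :
    g (∑ j, c j • X j) (∑ j, c j • X j) = ∑ j, c j ^ 2 := by
  rw [map_sum]
  exact Finset.sum_congr rfl fun j _ => by rw [map_smul, hX.inner_sum, smul_eq_mul, sq]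

theorem eq_sum_of_mem_horizontal (hX : IsHorizontalBasis G g X) {v : Pt m n}
    (hv : v ∈ horizontal G g) : v = ∑ j, g v (X j) • X j := by
  rw [← hX.span] at hv
  obtain ⟨c, rfl⟩ := (Submodule.mem_span_range_iff_exists_fun ℝ).1 hv
  simp only [hX.inner_sum]

theorem exists_sum_fst_eq (hX : IsHorizontalBasis G g X) (hG : IsHType G g) (a : Fin m → ℝ) :
    ∃ c : Fin m → ℝ, (∑ j, c j • X j).1 = a := by
  let T : (Fin m → ℝ) →ₗ[ℝ] (Fin m → ℝ) :=
    (LinearMap.fst ℝ (Fin m → ℝ) (Fin n → ℝ)).comp (Fintype.linearCombination ℝ X)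
  have hT : ∀ c, T c = (∑ j, c j • X j).1 := fun c => by
    simp [T, Fintype.linearCombination_apply]
  have hinj : Function.Injective T := (injective_iff_map_eq_zero T).2 fun c hc => funext fun i => by
    rw [hT] at hc
    rw [← hX.inner_sum c i, hX.inner_eq_zero_of_fst_eq_zero hG hc, Pi.zero_apply]
  simpa only [hT] using LinearMap.injective_iff_surjective.1 hinj a

theorem sub_sum_fst (hX : IsHorizontalBasis G g X) (hG : IsHType G g) (x : Pt m n) :
    (x - ∑ j, g x (X j) • X j).1 = 0 := by
  obtain ⟨c, hc⟩ := hX.exists_sum_fst_eq hG x.1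
  have hvert : (x - ∑ j, c j • X j).1 = 0 := by rw [Prod.fst_sub, hc, sub_self]
  have hcoord : ∀ i, g x (X i) = c i := fun i => by
    simpa only [map_sub, LinearMap.sub_apply, hX.inner_sum, sub_eq_zero] using
      hX.inner_eq_zero_of_fst_eq_zero hG hvert i
  simpa only [hcoord] using hvert

theorem bracketL_sum (hX : IsHorizontalBasis G g X) (hG : IsHType G g) (x w : Pt m n) :
    bracketL G (∑ j, g x (X j) • X j) w = bracketL G x w := by
  have h := bracketL_of_fst_eq_zero (G := G) (hX.sub_sum_fst hG x) w
  rw [map_sub, sub_apply, sub_eq_zero] at h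
  exact h.symm

end IsHorizontalBasis

end HorizontalFrame

section HTypeAlgebra

/-- The coordinates of the horizontal component of `x` in the frame `X`. -/
def horCoord (g : LinearMap.BilinForm ℝ (Pt m n)) (X : Fin m → Pt m n) (x : Pt m n) :
    Fin m → ℝ :=
  fun i => g x (X i)

/-- The squared norm of the horizontal component of `x`. -/
def horSq (g : LinearMap.BilinForm ℝ (Pt m n)) (X : Fin m → Pt m n) (x : Pt m n) : ℝ :=
  horCoord g X x ⬝ᵥ horCoord g X x

/-- The coordinates of `J_z v(x)` in the frame `X`, for `z` in the second layer. -/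
def jCoord (G : HomogeneousLieGroup m n) (g : LinearMap.BilinForm ℝ (Pt m n))
    (X : Fin m → Pt m n) (z x : Pt m n) : Fin m → ℝ :=
  fun i => g z (bracketL G x (X i))

theorem horSq_eq_sum_sq (g : LinearMap.BilinForm ℝ (Pt m n)) (X : Fin m → Pt m n) (x : Pt m n) :
    horSq g X x = ∑ i, g x (X i) ^ 2 := by
  simp only [horSq, horCoord, dotProduct, sq]

theorem horSq_nonneg (x : Pt m n) : 0 ≤ horSq g X x := by
  rw [horSq_eq_sum_sq]
  positivity

theorem vPart_eq (hG : IsHType G g) (hX : IsHorizontalBasis G g X) (x : Pt m n) :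
    vPart G g X x = ∑ j, g x (X j) • X j := by
  have hlog : ∀ j, g (logMap G x) (X j) = g x (X j) := fun j => by
    have htwist := hX.inner_eq_zero_of_fst_eq_zero hG (z := twist G x x) (by simp [twist_apply]) j
    simp [logMap_eq, htwist]
  simp only [vPart, hlog]

theorem inner_vPart_self (hG : IsHType G g) (hX : IsHorizontalBasis G g X) (x : Pt m n) :
    g (vPart G g X x) (vPart G g X x) = horSq g X x := by
  rw [vPart_eq hG hX, hX.inner_sum_self, horSq_eq_sum_sq]

theorem zPart_eq (hG : IsHType G g) (hX : IsHorizontalBasis G g X) (x : Pt m n) :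
    zPart G g X x = x - (1 / 2 : ℝ) • twist G x x - ∑ j, g x (X j) • X j := by
  rw [zPart, vPart_eq hG hX, logMap_eq]

theorem zPart_fst (hG : IsHType G g) (hX : IsHorizontalBasis G g X) (x : Pt m n) :
    (zPart G g X x).1 = 0 := by
  simpa [zPart_eq hG hX, twist_apply] using hX.sub_sum_fst hG x

theorem exists_isJMap_isometry (hG : IsHType G g) {z : Pt m n} (hz : z.1 = 0) (hz0 : z ≠ 0) :
    ∃ J : Pt m n → Pt m n, IsJMap G g z J ∧
      ∀ v ∈ horizontal G g, g (J v) (J v) = g z z * g v v := by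
  have hpos := hG.pos z hz0
  set s := √(g z z)
  have hs : s ≠ 0 := (Real.sqrt_pos.2 hpos).ne'
  have hsq : g z z = s * s := (Real.mul_self_sqrt hpos.le).symm
  obtain ⟨J, hJ, hisom⟩ := hG.orthogonal (s⁻¹ • z)
    (mem_lieCenter_of_fst_eq_zero (by simp [hz]))
    (by simp only [map_smul, LinearMap.smul_apply, smul_eq_mul, hsq]; field_simp)
  refine ⟨fun v => s • J v, fun v hv => ⟨fun w hw => ?_, fun w hw => ?_⟩, fun v hv => ?_⟩
  · simp [(hJ v hv).1 w hw]
  · simp [(hJ v hv).2 w hw, hs]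
  · simp only [map_smul, LinearMap.smul_apply, smul_eq_mul, hisom v hv v hv, hsq, mul_assoc]

theorem jCoord_dotProduct_self (hG : IsHType G g) (hX : IsHorizontalBasis G g X) {z : Pt m n}
    (hz : z.1 = 0) (x : Pt m n) :
    jCoord G g X z x ⬝ᵥ jCoord G g X z x = g z z * horSq g X x := by
  rcases eq_or_ne z 0 with rfl | hz0
  · simp [jCoord, dotProduct]
  obtain ⟨J, hJ, hisom⟩ := exists_isJMap_isometry hG hz hz0
  set v := ∑ j, g x (X j) • X j with hv
  have hvmem : v ∈ horizontal G g := hX.sum_mem_horizontal _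
  have hcoord : jCoord G g X z x = fun i => g (J v) (X i) := funext fun i => by
    rw [(hJ v hvmem).2 _ (hX.mem_horizontal i), bracket_eq_bracketL, hv, hX.bracketL_sum hG, jCoord]
  calc jCoord G g X z x ⬝ᵥ jCoord G g X z x = ∑ i, g (J v) (X i) ^ 2 := by
        simp only [hcoord, dotProduct, sq]
    _ = g (J v) (J v) := by
        rw [← hX.inner_sum_self, ← hX.eq_sum_of_mem_horizontal (hJ v hvmem).1]
    _ = g z z * horSq g X x := by
        rw [hisom v hvmem, hv, hX.inner_sum_self, horSq_eq_sum_sq]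

theorem horCoord_dotProduct_jCoord (hG : IsHType G g) (hX : IsHorizontalBasis G g X)
    (z x : Pt m n) : horCoord g X x ⬝ᵥ jCoord G g X z x = 0 := by
  have hsum : horCoord g X x ⬝ᵥ jCoord G g X z x =
      g z (bracketL G x (∑ i, g x (X i) • X i)) := by
    simp [horCoord, jCoord, dotProduct, map_sum]
  rw [hsum, bracketL_swap, hX.bracketL_sum hG, bracketL_self, neg_zero, map_zero]

/-- `e` is a `g`-orthonormal frame of the second layer. -/
structure IsVerticalFrame (g : LinearMap.BilinForm ℝ (Pt m n)) (e : Fin n → Pt m n) : Prop where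
  fst_eq_zero : ∀ k, (e k).1 = 0
  inner_self : ∀ k, g (e k) (e k) = 1
  inner_eq_sum : ∀ u w : Pt m n, u.1 = 0 → w.1 = 0 → g u w = ∑ k, g (e k) u * g (e k) w

theorem exists_isVerticalFrame (hG : IsHType G g) : ∃ e, IsVerticalFrame g e := by
  let ι := LinearMap.inr ℝ (Fin m → ℝ) (Fin n → ℝ)
  obtain ⟨e, hself, hsum⟩ := exists_orthonormal_family (B := g.compl₁₂ ι ι)
    (fun v w => hG.symm _ _)
    (fun v hv => hG.pos _ fun h => hv (congrArg Prod.snd h)) (Module.finrank_fin_fun ℝ (n := n))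
  refine ⟨fun k => ι (e k), fun k => rfl, hself, ?_⟩
  rintro ⟨_, u⟩ ⟨_, w⟩ rfl rfl
  exact hsum u w

/-- The fourth power of the gauge. -/
def gaugePow (G : HomogeneousLieGroup m n) (g : LinearMap.BilinForm ℝ (Pt m n))
    (X : Fin m → Pt m n) (x : Pt m n) : ℝ :=
  horSq g X x ^ 2 + 16 * g (zPart G g X x) (zPart G g X x)

theorem gaugePow_nonneg (hG : IsHType G g) (x : Pt m n) : 0 ≤ gaugePow G g X x :=
  add_nonneg (sq_nonneg _) (mul_nonneg (by norm_num) (hG.inner_self_nonneg _))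

theorem gaugeNorm_eq (hG : IsHType G g) (hX : IsHorizontalBasis G g X) (x : Pt m n) :
    gaugeNorm G g X x = gaugePow G g X x ^ (1 / 4 : ℝ) := by
  rw [gaugeNorm, inner_vPart_self hG hX, gaugePow]

/-- The horizontal gradient of the fourth power of the gauge. -/
def gaugeGrad (G : HomogeneousLieGroup m n) (g : LinearMap.BilinForm ℝ (Pt m n))
    (X : Fin m → Pt m n) (x : Pt m n) : Fin m → ℝ :=
  (4 * horSq g X x) • horCoord g X x + (16 : ℝ) • jCoord G g X (zPart G g X x) x

/-- The horizontal second derivatives of the fourth power of the gauge. -/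
def gaugeHess (G : HomogeneousLieGroup m n) (g : LinearMap.BilinForm ℝ (Pt m n))
    (X : Fin m → Pt m n) (x : Pt m n) (i j : Fin m) : ℝ :=
  8 * g x (X i) * g x (X j) + 4 * horSq g X x * (if i = j then 1 else 0)
    + 8 * g (bracketL G x (X i)) (bracketL G x (X j))
    + 16 * g (zPart G g X x) (bracketL G (X i) (X j))

theorem gaugeGrad_dotProduct_self (hG : IsHType G g) (hX : IsHorizontalBasis G g X) (x : Pt m n) :
    gaugeGrad G g X x ⬝ᵥ gaugeGrad G g X x = 16 * horSq g X x * gaugePow G g X x := by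
  simp only [gaugeGrad, add_dotProduct, dotProduct_add, smul_dotProduct, dotProduct_smul,
    smul_eq_mul, jCoord_dotProduct_self hG hX (zPart_fst hG hX x),
    dotProduct_comm (jCoord G g X _ x) (horCoord g X x), horCoord_dotProduct_jCoord hG hX,
    ← horSq.eq_1 g X x, gaugePow]
  ring

end HTypeAlgebra

section Landis

variable {A : Matrix (Fin m) (Fin m) ℝ} {lam Lam δ : ℝ}

theorem sum_mul_inner_bracketL {e : Fin n → Pt m n} (he : IsVerticalFrame g e)
    (A : Matrix (Fin m) (Fin m) ℝ) (x : Pt m n) :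
    ∑ i, ∑ j, A i j * g (bracketL G x (X i)) (bracketL G x (X j)) =
      ∑ k, (A *ᵥ jCoord G g X (e k) x) ⬝ᵥ jCoord G g X (e k) x := by
  simp only [mulVec_dotProduct_eq_sum,
    he.inner_eq_sum _ _ (bracketL_fst G x _) (bracketL_fst G x _), Finset.mul_sum]
  conv_rhs => rw [Finset.sum_comm]
  refine Finset.sum_congr rfl fun i _ => ?_
  conv_rhs => rw [Finset.sum_comm]
  rfl

theorem sum_mul_gaugeHess (hA : A.IsSymm) {e : Fin n → Pt m n} (he : IsVerticalFrame g e)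
    (x : Pt m n) :
    ∑ i, ∑ j, A i j * gaugeHess G g X x i j =
      8 * ((A *ᵥ horCoord g X x) ⬝ᵥ horCoord g X x) + 4 * horSq g X x * A.trace
        + 8 * ∑ k, (A *ᵥ jCoord G g X (e k) x) ⬝ᵥ jCoord G g X (e k) x := by
  have hanti : ∑ i, ∑ j, A i j * g (zPart G g X x) (bracketL G (X i) (X j)) = 0 :=
    sum_mul_eq_zero_of_isSymm hA fun i j => by rw [bracketL_swap, map_neg]
  have htrace : ∑ i, ∑ j, A i j * (if i = j then (1 : ℝ) else 0) = A.trace := by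
    simp [Matrix.trace]
  calc ∑ i, ∑ j, A i j * gaugeHess G g X x i j
      = 8 * (∑ i, ∑ j, A i j * (g x (X i) * g x (X j)))
        + 4 * horSq g X x * (∑ i, ∑ j, A i j * (if i = j then (1 : ℝ) else 0))
        + 8 * (∑ i, ∑ j, A i j * g (bracketL G x (X i)) (bracketL G x (X j)))
        + 16 * ∑ i, ∑ j, A i j * g (zPart G g X x) (bracketL G (X i) (X j)) := by
        simp only [Finset.mul_sum, ← Finset.sum_add_distrib]
        refine Finset.sum_congr rfl fun i _ => Finset.sum_congr rfl fun j _ => ?_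
        rw [gaugeHess]
        ring
    _ = _ := by
        rw [hanti, htrace, sum_mul_inner_bracketL he, mulVec_dotProduct_eq_sum A (horCoord g X x),
          mul_zero, add_zero]
        rfl

theorem sum_mul_gaugeHess_le (hG : IsHType G g) (hX : IsHorizontalBasis G g X)
    (hA : IsElliptic lam Lam A) (hL : Landis n δ A) (x : Pt m n) :
    ∑ i, ∑ j, A i j * gaugeHess G g X x i j ≤
      4 * horSq g X x * ((homDim m n + 4 - δ) * sInf (sphereValues A)) := by
  obtain ⟨e, he⟩ := exists_isVerticalFrame hG
  set M := sSup (sphereValues A) with hM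
  have hhor : (A *ᵥ horCoord g X x) ⬝ᵥ horCoord g X x ≤ M * horSq g X x :=
    le_sSup_sphereValues_mul hA.bddAbove_sphereValues _
  have hvert : ∑ k, (A *ᵥ jCoord G g X (e k) x) ⬝ᵥ jCoord G g X (e k) x ≤
      n * (M * horSq g X x) := by
    have hframe : ∀ k ∈ Finset.univ,
        (A *ᵥ jCoord G g X (e k) x) ⬝ᵥ jCoord G g X (e k) x ≤ M * horSq g X x := fun k _ => by
      simpa only [jCoord_dotProduct_self hG hX (he.fst_eq_zero k), he.inner_self, one_mul] using
        le_sSup_sphereValues_mul hA.bddAbove_sphereValues (jCoord G g X (e k) x)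
    simpa using Finset.sum_le_card_nsmul _ _ _ hframe
  have hLandis : A.trace + (2 * n + 2) * M ≤ (homDim m n + 4 - δ) * sInf (sphereValues A) := by
    have hdim : homDim m n + 2 - m = 2 * n + 2 := by unfold homDim; ring
    rwa [Landis, ← hM, hdim] at hL
  have hscaled := mul_le_mul_of_nonneg_left hLandis
    (mul_nonneg zero_le_four (horSq_nonneg (g := g) (X := X) x))
  rw [sum_mul_gaugeHess hA.1 he]
  linarith

theorem landis_bound (hG : IsHType G g) (hX : IsHorizontalBasis G g X)
    (hδ : δ ≤ homDim m n + 4) (hA : IsElliptic lam Lam A) (hL : Landis n δ A) (x : Pt m n) :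
    4 * gaugePow G g X x * ∑ i, ∑ j, A i j * gaugeHess G g X x i j ≤
      (homDim m n + 4 - δ) * ((A *ᵥ gaugeGrad G g X x) ⬝ᵥ gaugeGrad G g X x) := by
  have hpow : 0 ≤ gaugePow G g X x := gaugePow_nonneg hG x
  have hgrad := sInf_sphereValues_mul_le hA.bddBelow_sphereValues (gaugeGrad G g X x)
  rw [gaugeGrad_dotProduct_self hG hX] at hgrad
  calc 4 * gaugePow G g X x * ∑ i, ∑ j, A i j * gaugeHess G g X x i j
      ≤ 4 * gaugePow G g X x *
          (4 * horSq g X x * ((homDim m n + 4 - δ) * sInf (sphereValues A))) := by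
        gcongr
        exact sum_mul_gaugeHess_le hG hX hA hL x
    _ = (homDim m n + 4 - δ) *
          (sInf (sphereValues A) * (16 * horSq g X x * gaugePow G g X x)) := by ring
    _ ≤ _ := mul_le_mul_of_nonneg_left hgrad (by linarith)

end Landis

section Calculus

/-- The inner product as a continuous bilinear map. -/
abbrev innerL (g : LinearMap.BilinForm ℝ (Pt m n)) : Pt m n →L[ℝ] Pt m n →L[ℝ] ℝ :=
  LinearMap.toContinuousBilinearMap g

theorem contDiff_inner {E : Type*} [NormedAddCommGroup E] [NormedSpace ℝ E]
    (g : LinearMap.BilinForm ℝ (Pt m n)) {k : WithTop ℕ∞} {u v : E → Pt m n}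
    (hu : ContDiff ℝ k u) (hv : ContDiff ℝ k v) : ContDiff ℝ k fun x => g (u x) (v x) :=
  ((innerL g).contDiff.comp hu).clm_apply hv

theorem fderiv_inner_apply (g : LinearMap.BilinForm ℝ (Pt m n)) {u v : Pt m n → Pt m n}
    {x : Pt m n} (hu : DifferentiableAt ℝ u x) (hv : DifferentiableAt ℝ v x) (w : Pt m n) :
    fderiv ℝ (fun y => g (u y) (v y)) x w =
      g (fderiv ℝ u x w) (v x) + g (u x) (fderiv ℝ v x w) := by
  have hderiv : HasFDerivAt (fun y => g (u y) (v y)) _ x :=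
    (innerL g).hasFDerivAt_of_bilinear hu.hasFDerivAt hv.hasFDerivAt
  simp [hderiv.fderiv, add_comm]

theorem fderiv_inner_const_apply (g : LinearMap.BilinForm ℝ (Pt m n)) (v x w : Pt m n) :
    fderiv ℝ (fun y => g y v) x w = g w v := by
  simpa using fderiv_inner_apply g differentiableAt_id (differentiableAt_const v) w (x := x)

theorem contDiff_horSq (g : LinearMap.BilinForm ℝ (Pt m n)) (X : Fin m → Pt m n)
    {k : WithTop ℕ∞} : ContDiff ℝ k (horSq g X) := by
  rw [funext (horSq_eq_sum_sq g X)]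
  exact ContDiff.sum fun _ _ => (contDiff_inner g contDiff_id contDiff_const).pow 2

theorem contDiff_zPart (hG : IsHType G g) (hX : IsHorizontalBasis G g X) {k : WithTop ℕ∞} :
    ContDiff ℝ k (zPart G g X) := by
  have htwist : ContDiff ℝ k fun x => twist G x x := (twist G).contDiff.clm_apply contDiff_id
  rw [funext (zPart_eq hG hX)]
  exact (contDiff_id.sub (htwist.const_smul _)).sub
    (ContDiff.sum fun j _ => (contDiff_inner g contDiff_id contDiff_const).smul contDiff_const)

theorem contDiff_gaugePow (hG : IsHType G g) (hX : IsHorizontalBasis G g X) {k : WithTop ℕ∞} :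
    ContDiff ℝ k (gaugePow G g X) :=
  ((contDiff_horSq g X).pow 2).add
    (contDiff_const.mul (contDiff_inner g (contDiff_zPart hG hX) (contDiff_zPart hG hX)))

theorem contDiff_gaugeGrad (hG : IsHType G g) (hX : IsHorizontalBasis G g X) {k : WithTop ℕ∞}
    (i : Fin m) : ContDiff ℝ k fun x => gaugeGrad G g X x i := by
  have hbracket : ContDiff ℝ k fun x => bracketL G x (X i) :=
    (bracketL G).contDiff.clm_apply contDiff_const
  exact ((contDiff_const.mul (contDiff_horSq g X)).mul
    (contDiff_inner g contDiff_id contDiff_const)).add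
    (contDiff_const.mul (contDiff_inner g (contDiff_zPart hG hX) hbracket))

theorem inner_leftInv (hG : IsHType G g) (hX : IsHorizontalBasis G g X) (x : Pt m n)
    (i j : Fin m) : g (leftInv G (X i) x) (X j) = if i = j then 1 else 0 := by
  rw [leftInv_eq, map_add, LinearMap.add_apply,
    hX.inner_eq_zero_of_fst_eq_zero hG (z := twist G x (X i)) (by simp [twist_apply]), add_zero,
    hX.orthonormal]

theorem bracketL_leftInv (v w x : Pt m n) :
    bracketL G (leftInv G v x) w = bracketL G v w := by
  rw [leftInv_eq, map_add, add_apply,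
    bracketL_of_fst_eq_zero (z := twist G x v) (by simp [twist_apply]), add_zero]

theorem along_horSq (hG : IsHType G g) (hX : IsHorizontalBasis G g X) (i : Fin m) (x : Pt m n) :
    along G (X i) (horSq g X) x = 2 * g x (X i) := by
  have hdiff : ∀ j, DifferentiableAt ℝ (fun y => g y (X j)) x := fun j =>
    (contDiff_inner g contDiff_id contDiff_const (k := 1)).differentiable one_ne_zero x
  rw [along, funext (horSq_eq_sum_sq g X), fderiv_fun_sum fun j _ => (hdiff j).fun_pow 2]
  simp [fderiv_fun_pow _ (hdiff _), fderiv_inner_const_apply, inner_leftInv hG hX]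

theorem fderiv_zPart_leftInv (hG : IsHType G g) (hX : IsHorizontalBasis G g X) (i : Fin m)
    (x : Pt m n) :
    fderiv ℝ (zPart G g X) x (leftInv G (X i) x) = (1 / 2 : ℝ) • bracketL G x (X i) := by
  have htwist : HasFDerivAt (fun x => twist G x x) _ x :=
    (twist G).hasFDerivAt_of_bilinear (hasFDerivAt_id x) (hasFDerivAt_id x)
  have hproj : HasFDerivAt (fun x => ∑ j, g x (X j) • X j) _ x :=
    HasFDerivAt.fun_sum fun j _ => ((innerL g).flip (X j)).hasFDerivAt.smul_const (X j)
  have hderiv : HasFDerivAt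
      (fun x => x - (1 / 2 : ℝ) • twist G x x - ∑ j, g x (X j) • X j) _ x :=
    ((hasFDerivAt_id x).fun_sub (htwist.fun_const_smul _)).fun_sub hproj
  rw [funext (zPart_eq hG hX), hderiv.fderiv]
  simp only [sub_apply, sum_apply, ContinuousLinearMap.smulRight_apply,
    ContinuousLinearMap.flip_apply, LinearMap.toContinuousBilinearMap_apply, inner_leftInv hG hX]
  simp only [leftInv_eq, bracketL_apply]
  simp [twist_twist_left, twist_twist_right]
  module

theorem along_gaugePow (hG : IsHType G g) (hX : IsHorizontalBasis G g X) (j : Fin m)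
    (x : Pt m n) : along G (X j) (gaugePow G g X) x = gaugeGrad G g X x j := by
  have hhor : DifferentiableAt ℝ (horSq g X) x :=
    (contDiff_horSq g X (k := 1)).differentiable one_ne_zero x
  have hz : DifferentiableAt ℝ (zPart G g X) x :=
    (contDiff_zPart hG hX (k := 1)).differentiable one_ne_zero x
  have hzz : DifferentiableAt ℝ (fun y => g (zPart G g X y) (zPart G g X y)) x :=
    (contDiff_inner g (contDiff_zPart hG hX) (contDiff_zPart hG hX) (k := 1)).differentiable
      one_ne_zero x
  have hsq := along_horSq hG hX j x
  unfold along at hsq ⊢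
  unfold gaugePow
  rw [fderiv_fun_add (hhor.fun_pow 2) (hzz.const_mul 16), fderiv_fun_pow 2 hhor,
    fderiv_const_mul hzz]
  simp only [add_apply, smul_apply, hsq, fderiv_inner_apply g hz hz, fderiv_zPart_leftInv hG hX,
    map_smul, LinearMap.smul_apply, smul_eq_mul, hG.symm (bracketL G x (X j)), gaugeGrad, horCoord,
    jCoord, Pi.add_apply, Pi.smul_apply, nsmul_eq_mul]
  push_cast
  ring

theorem along_gaugeGrad (hG : IsHType G g) (hX : IsHorizontalBasis G g X) (i j : Fin m)
    (x : Pt m n) : along G (X i) (fun x => gaugeGrad G g X x j) x = gaugeHess G g X x i j := by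
  have hhor : DifferentiableAt ℝ (horSq g X) x :=
    (contDiff_horSq g X (k := 1)).differentiable one_ne_zero x
  have hcoord : DifferentiableAt ℝ (fun y => g y (X j)) x :=
    (contDiff_inner g contDiff_id contDiff_const (k := 1)).differentiable one_ne_zero x
  have hz : DifferentiableAt ℝ (zPart G g X) x :=
    (contDiff_zPart hG hX (k := 1)).differentiable one_ne_zero x
  have hbracket : HasFDerivAt (fun y => bracketL G y (X j)) ((bracketL G).flip (X j)) x :=
    ((bracketL G).flip (X j)).hasFDerivAt
  have hzb : DifferentiableAt ℝ (fun y => g (zPart G g X y) (bracketL G y (X j))) x :=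
    (contDiff_inner g (contDiff_zPart hG hX) ((bracketL G).flip (X j)).contDiff
      (k := 1)).differentiable one_ne_zero x
  have hsq := along_horSq hG hX i x
  unfold along at hsq ⊢
  simp only [gaugeGrad, horCoord, jCoord, Pi.add_apply, Pi.smul_apply, smul_eq_mul]
  rw [fderiv_fun_add ((hhor.const_mul 4).fun_mul hcoord) (hzb.const_mul 16),
    fderiv_fun_mul (hhor.const_mul 4) hcoord, fderiv_const_mul hhor, fderiv_const_mul hzb]
  simp only [add_apply, smul_apply, hsq, fderiv_inner_const_apply, inner_leftInv hG hX,
    fderiv_inner_apply g hz hbracket.differentiableAt, fderiv_zPart_leftInv hG hX, hbracket.fderiv,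
    ContinuousLinearMap.flip_apply, bracketL_leftInv, map_smul, LinearMap.smul_apply, smul_eq_mul,
    gaugeHess]
  ring

theorem along_eq {f : Pt m n → ℝ} {f' : Pt m n →L[ℝ] ℝ} {x : Pt m n} (h : HasFDerivAt f f' x)
    (w : Pt m n) : along G w f x = f' (leftInv G w x) := by
  rw [along, h.fderiv]

theorem along_along_comp_gaugePow (hG : IsHType G g) (hX : IsHorizontalBasis G g X) {Ψ : ℝ → ℝ}
    (hΨ : ContDiff ℝ 2 Ψ) (i j : Fin m) (x : Pt m n) :
    along G (X i) (along G (X j) fun y => Ψ (gaugePow G g X y)) x =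
      deriv (deriv Ψ) (gaugePow G g X x) * (gaugeGrad G g X x i * gaugeGrad G g X x j)
        + deriv Ψ (gaugePow G g X x) * gaugeHess G g X x i j := by
  have hpow : Differentiable ℝ (gaugePow G g X) :=
    (contDiff_gaugePow hG hX (k := 1)).differentiable one_ne_zero
  have hgrad : Differentiable ℝ fun x => gaugeGrad G g X x j :=
    (contDiff_gaugeGrad hG hX (k := 1) j).differentiable one_ne_zero
  have hcomp {Φ : ℝ → ℝ} (hΦ : ContDiff ℝ 1 Φ) (x : Pt m n) :
      HasFDerivAt (fun y => Φ (gaugePow G g X y))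
        (deriv Φ (gaugePow G g X x) • fderiv ℝ (gaugePow G g X) x) x :=
    ((hΦ.differentiable one_ne_zero) _).hasDerivAt.comp_hasFDerivAt x (hpow x).hasFDerivAt
  have hfirst : (along G (X j) fun y => Ψ (gaugePow G g X y)) =
      fun y => deriv Ψ (gaugePow G g X y) * gaugeGrad G g X y j := by
    funext y
    rw [along_eq (hcomp (hΨ.of_le one_le_two) y), ← along_gaugePow hG hX]
    rfl
  rw [hfirst, along_eq ((hcomp hΨ.deriv' x).fun_mul (hgrad x).hasFDerivAt),
    ← along_gaugeGrad hG hX, ← along_gaugePow hG hX i]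
  simp only [add_apply, smul_apply, smul_eq_mul, along]
  ring

theorem sum_along_along_comp_gaugePow (hG : IsHType G g) (hX : IsHorizontalBasis G g X)
    {Ψ : ℝ → ℝ} (hΨ : ContDiff ℝ 2 Ψ) (A : Matrix (Fin m) (Fin m) ℝ) (x : Pt m n) :
    ∑ i, ∑ j, A i j * along G (X i) (along G (X j) fun y => Ψ (gaugePow G g X y)) x =
      deriv (deriv Ψ) (gaugePow G g X x) * ((A *ᵥ gaugeGrad G g X x) ⬝ᵥ gaugeGrad G g X x)
        + deriv Ψ (gaugePow G g X x) * ∑ i, ∑ j, A i j * gaugeHess G g X x i j := by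
  simp only [along_along_comp_gaugePow hG hX hΨ, mulVec_dotProduct_eq_sum, Finset.mul_sum,
    ← Finset.sum_add_distrib]
  exact Finset.sum_congr rfl fun i _ => Finset.sum_congr rfl fun j _ => by ring

end Calculus

section LeftTranslation

theorem hasFDerivAt_mul_left (G : HomogeneousLieGroup m n) (y x : Pt m n) :
    HasFDerivAt (G.mul y) (ContinuousLinearMap.id ℝ (Pt m n) + twist G y) x := by
  rw [funext (mul_eq G y)]
  exact ((hasFDerivAt_id x).const_add y).add (twist G y).hasFDerivAt

theorem contDiff_mul_left (G : HomogeneousLieGroup m n) (y : Pt m n) {k : WithTop ℕ∞} :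
    ContDiff ℝ k (G.mul y) := by
  rw [funext (mul_eq G y)]
  exact (contDiff_const.add contDiff_id).add (twist G y).contDiff

theorem along_comp_mul_left (w y : Pt m n) {f : Pt m n → ℝ} (hf : Differentiable ℝ f) :
    along G w (fun x => f (G.mul y x)) = fun x => along G w f (G.mul y x) := by
  funext x
  have hderiv : HasFDerivAt (fun x => f (G.mul y x)) _ x :=
    (hf _).hasFDerivAt.comp x (hasFDerivAt_mul_left G y x)
  rw [along_eq hderiv, along, ContinuousLinearMap.comp_apply]
  congr 1
  simp only [leftInv_eq, mul_eq, add_apply, ContinuousLinearMap.id_apply, map_add,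
    twist_twist_left, twist_twist_right, add_zero]
  abel

theorem contDiff_along (G : HomogeneousLieGroup m n) (w : Pt m n) {f : Pt m n → ℝ}
    (hf : ContDiff ℝ ∞ f) : ContDiff ℝ ∞ (along G w f) := by
  have hfield : ContDiff ℝ ∞ (leftInv G w) := by
    rw [funext (leftInv_eq G w)]
    exact contDiff_const.add ((twist G).flip w).contDiff
  exact (hf.fderiv_right (by simp)).clm_apply hfield

theorem inv_inv_mul (G : HomogeneousLieGroup m n) (x y : Pt m n) :
    G.inv (G.mul (G.inv x) y) = G.mul (G.inv y) x := by
  simp only [inv_eq, mul_eq, map_add, map_neg, add_apply, neg_apply, twist_twist_left,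
    twist_twist_right, map_zero, zero_apply]
  abel

theorem mul_mul_inv_mul (G : HomogeneousLieGroup m n) (x y : Pt m n) :
    G.mul x (G.mul (G.inv x) y) = y := by
  rw [← G.mul_assoc, G.mul_inv, G.zero_mul]

theorem horCoord_inv (hG : IsHType G g) (hX : IsHorizontalBasis G g X) (x : Pt m n) :
    horCoord g X (G.inv x) = -horCoord g X x := by
  funext j
  rw [horCoord, inv_eq, map_add, LinearMap.add_apply,
    hX.inner_eq_zero_of_fst_eq_zero hG (z := twist G x x) (by simp [twist_apply])]
  simp [horCoord]

theorem horSq_inv (hG : IsHType G g) (hX : IsHorizontalBasis G g X) (x : Pt m n) :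
    horSq g X (G.inv x) = horSq g X x := by
  simp only [horSq, horCoord_inv hG hX, neg_dotProduct_neg]

theorem zPart_inv (hG : IsHType G g) (hX : IsHorizontalBasis G g X) (x : Pt m n) :
    zPart G g X (G.inv x) = -zPart G g X x := by
  have hcoord : ∀ j, g (G.inv x) (X j) = -g x (X j) := congrFun (horCoord_inv hG hX x)
  simp only [zPart_eq hG hX, hcoord]
  simp only [inv_eq, map_add, map_neg, add_apply, neg_apply, twist_twist_left,
    twist_twist_right, neg_smul, Finset.sum_neg_distrib]
  module

theorem gaugePow_inv (hG : IsHType G g) (hX : IsHorizontalBasis G g X) (x : Pt m n) :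
    gaugePow G g X (G.inv x) = gaugePow G g X x := by
  simp [gaugePow, horSq_inv hG hX, zPart_inv hG hX]

theorem gaugePow_inv_mul_comm (hG : IsHType G g) (hX : IsHorizontalBasis G g X) (x y : Pt m n) :
    gaugePow G g X (G.mul (G.inv x) y) = gaugePow G g X (G.mul (G.inv y) x) := by
  rw [← inv_inv_mul, gaugePow_inv hG hX]

end LeftTranslation

section Shear

/-- The shear `(a, b) ↦ (a, φ a + b)`. -/
def shear (φ : C(Fin m → ℝ, Fin n → ℝ)) : Pt m n ≃ₜ Pt m n where
  toFun p := (p.1, φ p.1 + p.2)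
  invFun p := (p.1, -φ p.1 + p.2)
  left_inv p := by simp
  right_inv p := by simp
  continuous_toFun := by fun_prop
  continuous_invFun := by fun_prop

theorem shear_apply (φ : C(Fin m → ℝ, Fin n → ℝ)) (p : Pt m n) :
    shear φ p = (p.1, φ p.1 + p.2) := rfl

theorem shear_symm_apply (φ : C(Fin m → ℝ, Fin n → ℝ)) (p : Pt m n) :
    (shear φ).symm p = (p.1, -φ p.1 + p.2) := rfl

theorem measurePreserving_shear (φ : C(Fin m → ℝ, Fin n → ℝ)) :
    MeasurePreserving (shear φ : Pt m n → Pt m n) := by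
  rw [Measure.volume_eq_prod]
  refine (MeasurePreserving.id volume).skew_product (g := fun a b => φ a + b) ?_ ?_
  · fun_prop
  · exact Eventually.of_forall fun a => (measurePreserving_add_left volume (φ a)).map_eq

instance isAddHaarMeasure_volume : (volume : Measure (Pt m n)).IsAddHaarMeasure := by
  rw [Measure.volume_eq_prod]
  exact Measure.prod.instIsAddHaarMeasure volume volume

theorem mul_eq_add_shear (G : HomogeneousLieGroup m n) (x : Pt m n) :
    G.mul x = fun y => x + shear (cocycle G x.1 : C(Fin m → ℝ, Fin n → ℝ)) y := by
  funext y
  ext i <;> simp [mul_eq, shear_apply, twist_apply]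
  ring

theorem measurePreserving_mul_left (G : HomogeneousLieGroup m n) (x : Pt m n) :
    MeasurePreserving (G.mul x) := by
  rw [mul_eq_add_shear]
  exact (measurePreserving_add_left volume x).comp (measurePreserving_shear _)

theorem measurableEmbedding_mul_left (G : HomogeneousLieGroup m n) (x : Pt m n) :
    MeasurableEmbedding (G.mul x) := by
  rw [mul_eq_add_shear]
  exact (measurableEmbedding_addLeft x).comp (shear _).measurableEmbedding

theorem integral_comp_mul_left (G : HomogeneousLieGroup m n) (x : Pt m n) (f : Pt m n → ℝ) :
    ∫ ξ, f (G.mul x ξ) = ∫ ξ, f ξ :=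
  (measurePreserving_mul_left G x).integral_comp (measurableEmbedding_mul_left G x) f

end Shear

section Splitting

theorem exists_pos_mul_norm_sq_le {E : Type*} [NormedAddCommGroup E] [NormedSpace ℝ E]
    [FiniteDimensional ℝ E] {f : E → ℝ} (hf : Continuous f)
    (hhom : ∀ (r : ℝ) (x : E), f (r • x) = r ^ 2 * f x) (hpos : ∀ x, x ≠ 0 → 0 < f x) :
    ∃ κ : ℝ, 0 < κ ∧ ∀ x, κ * ‖x‖ ^ 2 ≤ f x := by
  have hzero : f 0 = 0 := by simpa using hhom 0 0
  rcases subsingleton_or_nontrivial E with hE | hE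
  · exact ⟨1, one_pos, fun x => by simp [Subsingleton.elim x 0, hzero]⟩
  have : ProperSpace E := FiniteDimensional.proper ℝ E
  obtain ⟨u, hu, hmin⟩ := (isCompact_sphere (0 : E) 1).exists_isMinOn
    (NormedSpace.sphere_nonempty.2 zero_le_one) hf.continuousOn
  refine ⟨f u, hpos u (ne_zero_of_mem_unit_sphere ⟨u, hu⟩), fun x => ?_⟩
  rcases eq_or_ne x 0 with rfl | hx
  · simp [hzero]
  have hx' : ‖x‖ ≠ 0 := norm_ne_zero_iff.2 hx
  have hunit : ‖x‖⁻¹ • x ∈ Metric.sphere (0 : E) 1 := by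
    simp [norm_smul, inv_mul_cancel₀ hx']
  calc f u * ‖x‖ ^ 2 ≤ f (‖x‖⁻¹ • x) * ‖x‖ ^ 2 :=
        mul_le_mul_of_nonneg_right (hmin hunit) (sq_nonneg _)
    _ = f x := by rw [hhom]; field_simp

/-- The second-layer offset of `z(x)`: its coordinates are `verticalShift x.1 + x.2`. -/
def verticalShift (G : HomogeneousLieGroup m n) (g : LinearMap.BilinForm ℝ (Pt m n))
    (X : Fin m → Pt m n) : C(Fin m → ℝ, Fin n → ℝ) where
  toFun a := -((1 / 2 : ℝ) • cocycle G a a + ∑ j, innerL g (a, 0) (X j) • (X j).2)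

/-- The gauge to the fourth power as a function of the components of `x` in the splitting of the
Lie algebra into the orthogonal complement of its center and its center. -/
def splitPow (g : LinearMap.BilinForm ℝ (Pt m n)) (X : Fin m → Pt m n) (p : Pt m n) : ℝ :=
  horSq g X (p.1, 0) ^ 2 + 16 * g (0, p.2) (0, p.2)

theorem inner_basis_fst (hG : IsHType G g) (hX : IsHorizontalBasis G g X) (x : Pt m n)
    (j : Fin m) : g (x.1, 0) (X j) = g x (X j) := by
  have h := hX.inner_eq_zero_of_fst_eq_zero hG (z := x - (x.1, 0)) (by simp) j
  rw [map_sub, LinearMap.sub_apply, sub_eq_zero] at h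
  exact h.symm

theorem horSq_fst (hG : IsHType G g) (hX : IsHorizontalBasis G g X) (x : Pt m n) :
    horSq g X (x.1, 0) = horSq g X x := by
  simp only [horSq_eq_sum_sq, inner_basis_fst hG hX]

theorem zPart_eq_verticalShift (hG : IsHType G g) (hX : IsHorizontalBasis G g X) (x : Pt m n) :
    zPart G g X x = (0, verticalShift G g X x.1 + x.2) := by
  refine Prod.ext (zPart_fst hG hX x) ?_
  simp only [verticalShift, zPart_eq hG hX, twist_apply, ContinuousMap.coe_mk,
    LinearMap.toContinuousBilinearMap_apply, inner_basis_fst hG hX, Prod.snd_sub, Prod.smul_snd,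
    Prod.snd_sum]
  abel

theorem gaugePow_eq_splitPow (hG : IsHType G g) (hX : IsHorizontalBasis G g X) (x : Pt m n) :
    gaugePow G g X x = splitPow g X (shear (verticalShift G g X) x) := by
  rw [gaugePow, splitPow, zPart_eq_verticalShift hG hX, shear_apply]
  exact congrArg (· ^ 2 + _) (horSq_fst hG hX x).symm

theorem horSq_smul (r : ℝ) (x : Pt m n) : horSq g X (r • x) = r ^ 2 * horSq g X x := by
  simp only [horSq_eq_sum_sq, map_smul, LinearMap.smul_apply, smul_eq_mul, mul_pow,
    ← Finset.mul_sum]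

theorem splitPow_dil (r : ℝ) (p : Pt m n) : splitPow g X (dil r p) = r ^ 4 * splitPow g X p := by
  have hfst : (((dil r p).1, 0) : Pt m n) = r • (p.1, 0) := by simp [dil]
  have hsnd : ((0, (dil r p).2) : Pt m n) = r ^ 2 • (0, p.2) := by simp [dil]
  rw [splitPow, hfst, hsnd, splitPow, horSq_smul]
  simp only [map_smul, LinearMap.smul_apply, smul_eq_mul]
  ring

theorem continuous_splitPow : Continuous (splitPow g X) := by
  have hhor : Continuous fun p : Pt m n => horSq g X (p.1, 0) :=
    (contDiff_horSq g X (k := 0)).continuous.comp (by fun_prop)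
  have hvert : ContDiff ℝ 0 fun p : Pt m n => g (0, p.2) (0, p.2) :=
    contDiff_inner g (contDiff_const.prodMk contDiff_snd) (contDiff_const.prodMk contDiff_snd)
  exact (hhor.pow 2).add (continuous_const.mul hvert.continuous)

theorem horSq_pos (hG : IsHType G g) (hX : IsHorizontalBasis G g X) {x : Pt m n} (hx : x.1 ≠ 0) :
    0 < horSq g X x := by
  refine lt_of_le_of_ne (horSq_nonneg _) fun h => hx ?_
  have hcoord : ∀ j, g x (X j) = 0 := congrFun (dotProduct_self_eq_zero.1 h.symm)
  simpa [hcoord] using hX.sub_sum_fst hG x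

theorem exists_pos_mul_norm_sq_le_horSq (hG : IsHType G g) (hX : IsHorizontalBasis G g X) :
    ∃ κ : ℝ, 0 < κ ∧ ∀ a, κ * ‖a‖ ^ 2 ≤ horSq g X (a, 0) :=
  exists_pos_mul_norm_sq_le ((contDiff_horSq g X (k := 0)).continuous.comp (by fun_prop))
    (fun r a => by simpa using horSq_smul r ((a, 0) : Pt m n)) fun _ ha => horSq_pos hG hX ha

theorem exists_pos_mul_norm_sq_le_inner (hG : IsHType G g) :
    ∃ κ : ℝ, 0 < κ ∧ ∀ b : Fin n → ℝ, κ * ‖b‖ ^ 2 ≤ g ((0, b) : Pt m n) (0, b) := by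
  refine exists_pos_mul_norm_sq_le ?_ (fun r b => ?_)
    fun b hb => hG.pos _ fun h => hb (congrArg Prod.snd h)
  · exact (contDiff_inner (k := 0) g (contDiff_const.prodMk contDiff_id)
      (contDiff_const.prodMk contDiff_id)).continuous
  · have hsmul : ((0, r • b) : Pt m n) = r • (0, b) := by simp
    simp only [hsmul, map_smul, LinearMap.smul_apply, smul_eq_mul]
    ring

theorem isCompact_splitPow_le (hG : IsHType G g) (hX : IsHorizontalBasis G g X) (c : ℝ) :
    IsCompact {p : Pt m n | splitPow g X p ≤ c} := by
  obtain ⟨κ, hκ, hhor⟩ := exists_pos_mul_norm_sq_le_horSq hG hX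
  obtain ⟨μ, hμ, hvert⟩ := exists_pos_mul_norm_sq_le_inner hG
  refine Metric.isCompact_of_isClosed_isBounded
    (isClosed_le continuous_splitPow continuous_const)
    ((Metric.isBounded_closedBall (x := (0 : Pt m n))
      (r := max √(√c / κ) √(c / 16 / μ))).subset fun p hp => ?_)
  have hp' : horSq g X (p.1, 0) ^ 2 + 16 * g (0, p.2) (0, p.2) ≤ c := hp
  rw [mem_closedBall_zero_iff]
  refine max_le_max (Real.le_sqrt_of_sq_le ((le_div_iff₀' hκ).2 ((hhor p.1).trans ?_)))
    (Real.le_sqrt_of_sq_le ((le_div_iff₀' hμ).2 ((hvert p.2).trans ?_)))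
  · exact Real.le_sqrt_of_sq_le (by linarith [hG.inner_self_nonneg ((0, p.2) : Pt m n)])
  · linarith [sq_nonneg (horSq g X (p.1, 0))]

theorem isCompact_gaugePow_le (hG : IsHType G g) (hX : IsHorizontalBasis G g X) (c : ℝ) :
    IsCompact {x : Pt m n | gaugePow G g X x ≤ c} := by
  simp only [gaugePow_eq_splitPow hG hX]
  exact (shear (verticalShift G g X)).isCompact_preimage.2 (isCompact_splitPow_le hG hX c)

theorem volume_splitPow_le (p : ℝ) {r : ℝ} (hr : 0 < r) :
    volume {x : Pt m n | splitPow g X x ≤ r ^ 4 * p} =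
      ENNReal.ofReal (r ^ (m + 2 * n)) * volume {x : Pt m n | splitPow g X x ≤ p} := by
  let D : Pt m n →ₗ[ℝ] Pt m n := (r⁻¹ • LinearMap.id).prodMap ((r⁻¹ ^ 2) • LinearMap.id)
  have hD : ∀ x, D x = dil r⁻¹ x := fun x => rfl
  have hdet : LinearMap.det D = (r ^ (m + 2 * n))⁻¹ := by
    rw [LinearMap.det_prodMap, LinearMap.det_smul, LinearMap.det_smul]
    simp only [LinearMap.det_id, mul_one, Module.finrank_fin_fun]
    rw [← pow_mul, ← pow_add, inv_pow]
  have hpre : {x : Pt m n | splitPow g X x ≤ r ^ 4 * p} = D ⁻¹' {x | splitPow g X x ≤ p} := by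
    ext x
    simp only [mem_ofPred_eq, mem_preimage, hD, splitPow_dil]
    rw [inv_pow, inv_mul_le_iff₀ (by positivity)]
  rw [hpre, Measure.addHaar_preimage_linearMap volume (by rw [hdet]; positivity), hdet, inv_inv,
    abs_of_pos (by positivity)]

theorem volume_gaugePow_le (hG : IsHType G g) (hX : IsHorizontalBasis G g X) {r : ℝ}
    (hr : 0 < r) : volume {x : Pt m n | gaugePow G g X x ≤ r} =
      ENNReal.ofReal (r ^ (homDim m n / 4)) * volume {x : Pt m n | gaugePow G g X x ≤ 1} := by
  have hsplit : ∀ c, volume {x : Pt m n | gaugePow G g X x ≤ c} =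
      volume {x : Pt m n | splitPow g X x ≤ c} := fun c => by
    rw [← (measurePreserving_shear (verticalShift G g X)).measure_preimage
      (isClosed_le continuous_splitPow continuous_const).measurableSet.nullMeasurableSet]
    simp only [gaugePow_eq_splitPow hG hX, preimage_ofPred_eq]
  have hroot : (r ^ (1 / 4 : ℝ)) ^ 4 = r := by
    rw [← Real.rpow_mul_natCast hr.le]
    norm_num
  have hdim : (r ^ (1 / 4 : ℝ)) ^ (m + 2 * n) = r ^ (homDim m n / 4) := by
    rw [← Real.rpow_mul_natCast hr.le, homDim]
    push_cast
    ring_nf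
  rw [hsplit, hsplit, ← hdim, ← volume_splitPow_le 1 (Real.rpow_pos_of_pos hr _), mul_one, hroot]

/-- The dilations that act on `v(x)` with weight one and on `z(x)` with weight two; they differ from
`dil` when the orthogonal complement of the center is not the first layer. -/
def splitDil (G : HomogeneousLieGroup m n) (g : LinearMap.BilinForm ℝ (Pt m n))
    (X : Fin m → Pt m n) (r : ℝ) (x : Pt m n) : Pt m n :=
  (shear (verticalShift G g X)).symm (dil r (shear (verticalShift G g X) x))

theorem gaugePow_splitDil (hG : IsHType G g) (hX : IsHorizontalBasis G g X) (r : ℝ) (x : Pt m n) :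
    gaugePow G g X (splitDil G g X r x) = r ^ 4 * gaugePow G g X x := by
  rw [gaugePow_eq_splitPow hG hX, splitDil, Homeomorph.apply_symm_apply, splitPow_dil,
    ← gaugePow_eq_splitPow hG hX]

theorem splitDil_fst (r : ℝ) (x : Pt m n) : (splitDil G g X r x).1 = r • x.1 := rfl

theorem splitDil_one (x : Pt m n) : splitDil G g X 1 x = x := by
  have hdil : ∀ p : Pt m n, dil 1 p = p := fun p => by simp [dil]
  rw [splitDil, hdil, Homeomorph.symm_apply_apply]

theorem splitDil_zero (x : Pt m n) : splitDil G g X 0 x = 0 := by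
  have hinner : ((0, 0) : Pt m n) = 0 := rfl
  simp [splitDil, shear_symm_apply, dil, verticalShift, hinner]

theorem continuous_splitDil (x : Pt m n) : Continuous fun r : ℝ => splitDil G g X r x :=
  (Homeomorph.continuous _).comp (by unfold dil; fun_prop)

theorem exists_gaugePow_eq (hG : IsHType G g) (hX : IsHorizontalBasis G g X) (hm : 0 < m) {c : ℝ}
    (hc : 0 < c) : ∃ x, gaugePow G g X x = c ∧ 0 < horSq g X x := by
  have : Nonempty (Fin m) := ⟨⟨0, hm⟩⟩
  obtain ⟨a, ha⟩ := exists_ne (0 : Fin m → ℝ)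
  have hhor := horSq_pos hG hX (x := (a, 0)) ha
  have hpos : 0 < gaugePow G g X (a, 0) :=
    add_pos_of_pos_of_nonneg (by positivity)
      (mul_nonneg (by norm_num) (hG.inner_self_nonneg _))
  have hratio : 0 < c / gaugePow G g X (a, 0) := by positivity
  refine ⟨splitDil G g X ((c / gaugePow G g X (a, 0)) ^ (1 / 4 : ℝ)) (a, 0), ?_, ?_⟩
  · rw [gaugePow_splitDil hG hX, ← Real.rpow_mul_natCast hratio.le]
    norm_num [hpos.ne']
  · refine horSq_pos hG hX ?_
    rw [splitDil_fst]
    exact smul_ne_zero (by positivity) ha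

end Splitting

section GaugeDistance

theorem gaugeNorm_nonneg (hG : IsHType G g) (hX : IsHorizontalBasis G g X) (x : Pt m n) :
    0 ≤ gaugeNorm G g X x := by
  rw [gaugeNorm_eq hG hX]
  exact Real.rpow_nonneg (gaugePow_nonneg hG x) _

theorem gaugePow_eq_gaugeNorm_pow (hG : IsHType G g) (hX : IsHorizontalBasis G g X) (x : Pt m n) :
    gaugePow G g X x = gaugeNorm G g X x ^ 4 := by
  rw [gaugeNorm_eq hG hX, ← Real.rpow_mul_natCast (gaugePow_nonneg hG x)]
  norm_num

theorem gaugeNorm_le_iff (hG : IsHType G g) (hX : IsHorizontalBasis G g X) {x y : Pt m n} :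
    gaugeNorm G g X x ≤ gaugeNorm G g X y ↔ gaugePow G g X x ≤ gaugePow G g X y := by
  rw [gaugePow_eq_gaugeNorm_pow hG hX, gaugePow_eq_gaugeNorm_pow hG hX,
    pow_le_pow_iff_left₀ (gaugeNorm_nonneg hG hX x) (gaugeNorm_nonneg hG hX y) four_ne_zero]

theorem gaugeDist_le (hG : IsHType G g) (hX : IsHorizontalBasis G g X) {S T : Set (Pt m n)}
    {x ξ : Pt m n} (hx : x ∈ S) (hξ : ξ ∈ T) :
    gaugeDist G g X S T ≤ gaugeNorm G g X (G.mul (G.inv ξ) x) := by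
  refine csInf_le ⟨0, ?_⟩ ⟨x, hx, ξ, hξ, rfl⟩
  rintro _ ⟨-, -, -, -, rfl⟩
  exact gaugeNorm_nonneg hG hX _

theorem inter_frontier_nonempty_of_isPreconnected {Y : Type*} [TopologicalSpace Y] {s t : Set Y}
    (ht : IsPreconnected t) (hts : (t ∩ s).Nonempty) (hsub : ¬t ⊆ s) :
    (t ∩ frontier s).Nonempty := by
  by_contra hempty
  have hcover : t ⊆ interior s ∪ interior sᶜ := by
    rw [← compl_frontier_eq_union_interior, subset_compl_iff_disjoint_right]
    exact disjoint_iff_inter_eq_empty.2 (not_nonempty_iff_eq_empty.1 hempty)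
  obtain ⟨y, hyt, hys⟩ := hts
  have hint : y ∈ interior s := (hcover hyt).resolve_right fun h => interior_subset h hys
  exact hsub ((ht.subset_left_of_subset_union isOpen_interior isOpen_interior
    (disjoint_compl_right.mono interior_subset interior_subset) hcover
    ⟨y, hyt, hint⟩).trans interior_subset)

-- The path `t ↦ x ∘ splitDil t y` starts in `O`, and all its points are closer to `x` than `∂O` is.
theorem mul_mem_of_lt_gaugeDist (hG : IsHType G g) (hX : IsHorizontalBasis G g X)
    {O O' : Set (Pt m n)} (hO' : O' ⊆ O) {x y : Pt m n} (hx : x ∈ O')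
    (hy : gaugeNorm G g X y < gaugeDist G g X O' (frontier O)) : G.mul x y ∈ O := by
  by_contra hmem
  let c : ℝ → Pt m n := fun t => G.mul x (splitDil G g X t y)
  have hc : Continuous c :=
    (contDiff_mul_left G x (k := 0)).continuous.comp (continuous_splitDil y)
  have hc0 : c 0 ∈ O := by simpa [c, splitDil_zero, G.mul_zero] using hO' hx
  have hc1 : c 1 ∉ O := by simpa [c, splitDil_one] using hmem
  obtain ⟨_, ⟨t, ht, rfl⟩, hfrontier⟩ := inter_frontier_nonempty_of_isPreconnected
    (isPreconnected_Icc.image c hc.continuousOn)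
    ⟨c 0, ⟨0, left_mem_Icc.2 zero_le_one, rfl⟩, hc0⟩
    fun h => hc1 (h ⟨1, right_mem_Icc.2 zero_le_one, rfl⟩)
  have hdist : gaugeNorm G g X (G.mul (G.inv (c t)) x) ≤ gaugeNorm G g X y := by
    rw [gaugeNorm_le_iff hG hX, gaugePow_inv_mul_comm hG hX, ← G.mul_assoc, G.inv_mul, G.zero_mul,
      gaugePow_splitDil hG hX]
    exact mul_le_of_le_one_left (gaugePow_nonneg hG y) (pow_le_one₀ ht.1 ht.2)
  exact absurd ((gaugeDist_le hG hX hx hfrontier).trans hdist) hy.not_ge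

end GaugeDistance

section Integrability

-- Layer cake: for `1 < t` the superlevel set `{t < f ^ (-p)}` has measure `O(t ^ (-q / p))`.
theorem integrableOn_rpow_neg_of_measure_le {Y : Type*} [MeasurableSpace Y] {μ : Measure Y}
    {f : Y → ℝ} (hf : Measurable f) (hf0 : ∀ y, 0 ≤ f y) {p q : ℝ} (hp : 0 < p) (hpq : p < q)
    {V : ENNReal} (hV : V ≠ ⊤)
    (hvol : ∀ r, 0 < r → r ≤ 1 → μ {y | f y ≤ r} ≤ ENNReal.ofReal (r ^ q) * V) :
    IntegrableOn (fun y => f y ^ (-p)) {y | f y ≤ 1} μ := by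
  have hmeas : Measurable fun y => f y ^ (-p) := hf.pow_const _
  have hnonneg : ∀ y, 0 ≤ f y ^ (-p) := fun y => Real.rpow_nonneg (hf0 y) _
  have hball : μ {y | f y ≤ 1} ≤ V := by simpa using hvol 1 one_pos le_rfl
  have hlevel : ∀ t ∈ Ioi (1 : ℝ), μ.restrict {y | f y ≤ 1} {y | t < f y ^ (-p)} ≤
      ENNReal.ofReal (t ^ (-(q / p))) * V := fun t ht => by
    have ht0 : 0 < t := one_pos.trans ht
    have hexp : (t ^ (-p)⁻¹) ^ q = t ^ (-(q / p)) := by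
      rw [← Real.rpow_mul ht0.le, inv_neg]
      ring_nf
    have hsub : {y | t < f y ^ (-p)} ⊆ {y | f y ≤ t ^ (-p)⁻¹} := fun y hy => by
      rcases (hf0 y).eq_or_lt with h0 | h0
      · exact h0.symm.le.trans (by positivity)
      · exact (Real.le_rpow_inv_iff_of_neg h0 ht0 (neg_lt_zero.2 hp)).2 (le_of_lt hy)
    rw [← hexp]
    refine (Measure.restrict_apply_le _ _).trans ((measure_mono hsub).trans
      (hvol _ (by positivity) (Real.rpow_le_one_of_one_le_of_nonpos (le_of_lt ht) ?_)))
    rw [inv_neg]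
    exact neg_nonpos.2 (inv_nonneg.2 hp.le)
  refine ⟨hmeas.aestronglyMeasurable, ?_⟩
  rw [HasFiniteIntegral, lintegral_enorm_of_nonneg hnonneg,
    lintegral_eq_lintegral_meas_lt _ (Eventually.of_forall hnonneg) hmeas.aemeasurable,
    ← Ioc_union_Ioi_eq_Ioi zero_le_one]
  refine (lintegral_union_le _ _ _).trans_lt (ENNReal.add_lt_top.2 ⟨?_, ?_⟩)
  · calc ∫⁻ t in Ioc (0 : ℝ) 1, μ.restrict {y | f y ≤ 1} {y | t < f y ^ (-p)}
        ≤ ∫⁻ _ in Ioc (0 : ℝ) 1, V := setLIntegral_mono measurable_const fun t _ =>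
          (measure_mono (subset_univ _)).trans (by simpa using hball)
      _ < ⊤ := by simpa using hV.lt_top
  · refine (setLIntegral_mono (by fun_prop) hlevel).trans_lt ?_
    rw [lintegral_mul_const _ (by fun_prop)]
    refine ENNReal.mul_lt_top ?_ hV.lt_top
    exact (integrableOn_Ioi_rpow_of_lt (by rwa [neg_lt_neg_iff, one_lt_div hp])
      one_pos).lintegral_lt_top

theorem continuous_gaugePow (hG : IsHType G g) (hX : IsHorizontalBasis G g X) :
    Continuous (gaugePow G g X) :=
  (contDiff_gaugePow hG hX (k := 0)).continuous

theorem continuous_gaugeNorm (hG : IsHType G g) (hX : IsHorizontalBasis G g X) :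
    Continuous (gaugeNorm G g X) := by
  rw [funext (gaugeNorm_eq hG hX)]
  exact (continuous_gaugePow hG hX).rpow_const fun _ => Or.inr (by norm_num)

theorem measurableSet_gaugePow_le (hG : IsHType G g) (hX : IsHorizontalBasis G g X) (c : ℝ) :
    MeasurableSet {x : Pt m n | gaugePow G g X x ≤ c} :=
  (isClosed_le (continuous_gaugePow hG hX) continuous_const).measurableSet

theorem integrableOn_gaugePow_rpow (hG : IsHType G g) (hX : IsHorizontalBasis G g X) {α : ℝ}
    (hα : 0 < α) (hαQ : α < homDim m n) :
    IntegrableOn (fun x => gaugePow G g X x ^ (-(α / 4))) {x | gaugePow G g X x ≤ 1} :=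
  integrableOn_rpow_neg_of_measure_le (q := homDim m n / 4) (continuous_gaugePow hG hX).measurable
    (gaugePow_nonneg hG) (by positivity) (by gcongr)
    (isCompact_gaugePow_le hG hX 1).measure_lt_top.ne
    fun _ hr _ => (volume_gaugePow_le hG hX hr).le

/-- The singular kernel truncated to a ball: `d ^ (-α)` where `d ^ 4 ≤ c`, and zero elsewhere. -/
def truncPow (G : HomogeneousLieGroup m n) (g : LinearMap.BilinForm ℝ (Pt m n))
    (X : Fin m → Pt m n) (α c : ℝ) : Pt m n → ℝ :=
  {x | gaugePow G g X x ≤ c}.indicator fun x => gaugePow G g X x ^ (-(α / 4))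

theorem truncPow_nonneg (hG : IsHType G g) (α c : ℝ) (x : Pt m n) :
    0 ≤ truncPow G g X α c x :=
  indicator_nonneg (fun x _ => Real.rpow_nonneg (gaugePow_nonneg hG x) _) x

theorem truncPow_mono (hG : IsHType G g) (α : ℝ) {c c' : ℝ} (h : c ≤ c') (x : Pt m n) :
    truncPow G g X α c x ≤ truncPow G g X α c' x :=
  indicator_le_indicator_of_subset (fun _ hx => le_trans hx h)
    (fun x => Real.rpow_nonneg (gaugePow_nonneg hG x) _) x

theorem measurable_truncPow (hG : IsHType G g) (hX : IsHorizontalBasis G g X) (α c : ℝ) :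
    Measurable (truncPow G g X α c) :=
  ((continuous_gaugePow hG hX).measurable.pow_const _).indicator
    (measurableSet_gaugePow_le hG hX c)

theorem integrable_truncPow (hG : IsHType G g) (hX : IsHorizontalBasis G g X) {α : ℝ}
    (hα : 0 < α) (hαQ : α < homDim m n) {c : ℝ} (hc : c ≤ 1) : Integrable (truncPow G g X α c) := by
  have hone : Integrable (truncPow G g X α 1) :=
    (integrable_indicator_iff (measurableSet_gaugePow_le hG hX 1)).2
      (integrableOn_gaugePow_rpow hG hX hα hαQ)
  refine hone.mono' (measurable_truncPow hG hX α c).aestronglyMeasurable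
    (Eventually.of_forall fun y => ?_)
  rw [Real.norm_of_nonneg (truncPow_nonneg hG _ _ _)]
  exact truncPow_mono hG α hc y

theorem gaugePow_rpow_le (hG : IsHType G g) {α : ℝ} (hα : 0 < α) (x : Pt m n) :
    gaugePow G g X x ^ (-(α / 4)) ≤ truncPow G g X α 1 x + 1 := by
  by_cases hx : gaugePow G g X x ≤ 1
  · rw [truncPow, indicator_of_mem (show x ∈ {x | gaugePow G g X x ≤ 1} from hx)]
    exact le_add_of_nonneg_right zero_le_one
  · exact (Real.rpow_le_one_of_one_le_of_nonpos (not_le.1 hx).le (by linarith)).trans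
      (le_add_of_nonneg_left (truncPow_nonneg hG α 1 x))

theorem tendsto_integral_truncPow (hG : IsHType G g) (hX : IsHorizontalBasis G g X) {α : ℝ}
    (hα : 0 < α) (hαQ : α < homDim m n) :
    Tendsto (fun c => ∫ y, truncPow G g X α c y) (𝓝[>] 0) (𝓝 0) := by
  suffices h : Tendsto (fun c => ∫ y, truncPow G g X α c y) (𝓝[>] 0) (𝓝 (∫ _ : Pt m n, (0 : ℝ))) by
    rwa [integral_zero] at h
  refine tendsto_integral_filter_of_dominated_convergence (truncPow G g X α 1)
    (Eventually.of_forall fun c => (measurable_truncPow hG hX α c).aestronglyMeasurable) ?_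
    (integrable_truncPow hG hX hα hαQ le_rfl) (Eventually.of_forall fun y => ?_)
  · filter_upwards [nhdsWithin_le_nhds (Iio_mem_nhds one_pos)] with c hc
    refine Eventually.of_forall fun y => ?_
    rw [Real.norm_of_nonneg (truncPow_nonneg hG _ _ _)]
    exact truncPow_mono hG α (le_of_lt hc) y
  · refine tendsto_const_nhds.congr' ?_
    rcases (gaugePow_nonneg hG y (X := X)).eq_or_lt with h | h
    · refine Eventually.of_forall fun c => (indicator_apply_eq_zero.2 fun _ => ?_).symm
      rw [← h, Real.zero_rpow (by linarith)]
    · filter_upwards [nhdsWithin_le_nhds (Iio_mem_nhds h)] with c hc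
      exact (indicator_of_notMem (fun hy => (mem_ofPred_eq.mp hy).not_gt hc) _).symm

theorem kernel_eq (hG : IsHType G g) (hX : IsHorizontalBasis G g X) (α : ℝ) (x ξ : Pt m n) :
    kernel G g X α x ξ = gaugePow G g X (G.mul (G.inv x) ξ) ^ (-(α / 4)) := by
  rw [kernel, gaugeNorm_eq hG hX, ← Real.rpow_mul (gaugePow_nonneg hG _)]
  ring_nf

theorem kernel_nonneg (hG : IsHType G g) (hX : IsHorizontalBasis G g X) (α : ℝ) (x ξ : Pt m n) :
    0 ≤ kernel G g X α x ξ :=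
  Real.rpow_nonneg (gaugeNorm_nonneg hG hX _) _

theorem integrableOn_kernel (hG : IsHType G g) (hX : IsHorizontalBasis G g X) {α : ℝ}
    (hα : 0 < α) (hαQ : α < homDim m n) {O : Set (Pt m n)} (hO : volume O ≠ ⊤) (x : Pt m n) :
    IntegrableOn (kernel G g X α x) O := by
  have hmp := measurePreserving_mul_left G (G.inv x)
  have hint : IntegrableOn (fun ξ => truncPow G g X α 1 (G.mul (G.inv x) ξ) + 1) O :=
    (hmp.integrable_comp_of_integrable
      (integrable_truncPow hG hX hα hαQ le_rfl)).integrableOn.add (integrableOn_const hO)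
  have hmeas : Measurable (kernel G g X α x) :=
    ((continuous_gaugeNorm hG hX).measurable.comp hmp.measurable).pow_const _
  refine hint.mono' hmeas.aestronglyMeasurable (Eventually.of_forall fun ξ => ?_)
  rw [Real.norm_of_nonneg (kernel_nonneg hG hX α x ξ), kernel_eq hG hX]
  exact gaugePow_rpow_le hG hα _

theorem integrableOn_cutKernel (hG : IsHType G g) (hX : IsHorizontalBasis G g X) {α : ℝ}
    (hα : 0 < α) (hαQ : α < homDim m n) {O : Set (Pt m n)} (hO : volume O ≠ ⊤) {ε : ℝ} {η : ℝ → ℝ}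
    (hη : IsCutoff ε η) (x : Pt m n) : IntegrableOn (cutKernel G g X α η x) O := by
  have hcont : Continuous fun ξ => η (gaugeNorm G g X (G.mul (G.inv x) ξ)) :=
    hη.smooth.continuousOn.comp_continuous
      ((continuous_gaugeNorm hG hX).comp (contDiff_mul_left G (G.inv x) (k := 0)).continuous)
      fun ξ => gaugeNorm_nonneg hG hX _
  refine (integrableOn_kernel hG hX hα hαQ hO x).bdd_mul (c := 1) hcont.aestronglyMeasurable
    (Eventually.of_forall fun ξ => ?_)
  have hd := gaugeNorm_nonneg hG hX (G.mul (G.inv x) ξ)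
  rw [Real.norm_of_nonneg (hη.nonneg _ hd)]
  exact hη.le_one _ hd

theorem IsCutoff.abs_sub_le (hG : IsHType G g) (hX : IsHorizontalBasis G g X) {α ε : ℝ}
    {η : ℝ → ℝ} (hη : IsCutoff ε η) (x ξ : Pt m n) :
    |cutKernel G g X α η x ξ - kernel G g X α x ξ| ≤
      truncPow G g X α ((2 * ε) ^ 4) (G.mul (G.inv x) ξ) := by
  have hd := gaugeNorm_nonneg hG hX (G.mul (G.inv x) ξ)
  have hk := kernel_nonneg hG hX α x ξ
  rw [cutKernel]
  rcases le_or_gt (2 * ε) (gaugeNorm G g X (G.mul (G.inv x) ξ)) with h | h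
  · simpa [hη.eq_one _ h] using truncPow_nonneg hG α _ _
  · have hmem : G.mul (G.inv x) ξ ∈ {y | gaugePow G g X y ≤ (2 * ε) ^ 4} := by
      rw [mem_ofPred_eq, gaugePow_eq_gaugeNorm_pow hG hX]
      exact pow_le_pow_left₀ hd h.le 4
    rw [truncPow, indicator_of_mem hmem, ← kernel_eq hG hX, ← sub_one_mul, abs_mul,
      abs_of_nonneg hk]
    refine mul_le_of_le_one_left hk (abs_le.2 ⟨?_, ?_⟩) <;>
      linarith [hη.nonneg _ hd, hη.le_one _ hd]

theorem abs_cutBarrier_sub_le (hG : IsHType G g) (hX : IsHorizontalBasis G g X) {α ε : ℝ}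
    (hα : 0 < α) (hαQ : α < homDim m n) (hε : (2 * ε) ^ 4 ≤ 1) {η : ℝ → ℝ} (hη : IsCutoff ε η)
    {O : Set (Pt m n)} (hO : volume O ≠ ⊤) (x : Pt m n) :
    |cutBarrier G g X α η O x - barrier G g X α O x| ≤
      1 / α * ∫ y, truncPow G g X α ((2 * ε) ^ 4) y := by
  have hk := integrableOn_kernel hG hX hα hαQ hO x
  have hcut := integrableOn_cutKernel hG hX hα hαQ hO hη x
  have htrunc : Integrable fun ξ => truncPow G g X α ((2 * ε) ^ 4) (G.mul (G.inv x) ξ) :=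
    (measurePreserving_mul_left G _).integrable_comp_of_integrable
      (integrable_truncPow hG hX hα hαQ hε)
  rw [cutBarrier, barrier, ← mul_sub, abs_mul, abs_neg, abs_of_pos (by positivity : 0 < 1 / α),
    ← integral_sub hcut hk]
  gcongr
  calc |∫ ξ in O, (cutKernel G g X α η x ξ - kernel G g X α x ξ)|
      ≤ ∫ ξ in O, |cutKernel G g X α η x ξ - kernel G g X α x ξ| := abs_integral_le_integral_abs
    _ ≤ ∫ ξ in O, truncPow G g X α ((2 * ε) ^ 4) (G.mul (G.inv x) ξ) :=
        integral_mono (hcut.sub hk).abs htrunc.integrableOn fun ξ => hη.abs_sub_le hG hX x ξ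
    _ ≤ ∫ ξ, truncPow G g X α ((2 * ε) ^ 4) (G.mul (G.inv x) ξ) :=
        setIntegral_le_integral htrunc (Eventually.of_forall fun ξ => truncPow_nonneg hG _ _ _)
    _ = ∫ y, truncPow G g X α ((2 * ε) ^ 4) y := integral_comp_mul_left G _ _

theorem tendstoUniformly_cutBarrier (hG : IsHType G g) (hX : IsHorizontalBasis G g X) {α : ℝ}
    (hα : 0 < α) (hαQ : α < homDim m n) {O : Set (Pt m n)} (hO : volume O ≠ ⊤) {η : ℝ → ℝ → ℝ}
    (hη : ∀ ε, 0 < ε → IsCutoff ε (η ε)) :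
    TendstoUniformly (fun ε => cutBarrier G g X α (η ε) O) (barrier G g X α O) (𝓝[>] 0) := by
  have hpow : Tendsto (fun ε : ℝ => (2 * ε) ^ 4) (𝓝[>] 0) (𝓝[>] 0) := by
    refine tendsto_nhdsWithin_iff.2 ⟨?_, ?_⟩
    · exact (Continuous.tendsto' (by fun_prop) 0 0 (by simp)).mono_left nhdsWithin_le_nhds
    · filter_upwards [self_mem_nhdsWithin] with ε (hε : 0 < ε)
      exact mem_Ioi.2 (by positivity)
  have hlim := ((tendsto_integral_truncPow hG hX hα hαQ).comp hpow).const_mul (1 / α)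
  rw [mul_zero] at hlim
  rw [Metric.tendstoUniformly_iff]
  intro e he
  filter_upwards [hlim.eventually_lt_const he, self_mem_nhdsWithin,
    hpow.eventually (nhdsWithin_le_nhds (Iio_mem_nhds one_pos))] with ε hsmall hε hε1 x
  rw [dist_comm, Real.dist_eq]
  exact (abs_cutBarrier_sub_le hG hX hα hαQ (le_of_lt hε1) (hη ε hε) hO x).trans_lt hsmall

end Integrability

section ParametricIntegral

variable {F H : Type*} [NormedAddCommGroup F] [NormedAddCommGroup H] [ProperSpace H]
  [MeasurableSpace H] [BorelSpace H] {μ : Measure H} [IsFiniteMeasureOnCompacts μ] {S : Set H}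

theorem integrableOn_of_continuous_of_isBounded {f : H → F} (hf : Continuous f)
    (hS : Bornology.IsBounded S) : IntegrableOn f S μ :=
  (hf.continuousOn.integrableOn_compact hS.isCompact_closure).mono_set subset_closure

variable {E : Type*} [NormedAddCommGroup E] [NormedSpace ℝ E] [FiniteDimensional ℝ E]
  [NormedSpace ℝ F] [NormedSpace ℝ H]

theorem hasFDerivAt_setIntegral {K : E × H → F} (hK : ContDiff ℝ 1 K)
    (hS : Bornology.IsBounded S) (x : E) :
    HasFDerivAt (fun x => ∫ ξ in S, K (x, ξ) ∂μ)
      (∫ ξ in S, (fderiv ℝ K (x, ξ)).comp (ContinuousLinearMap.inl ℝ E H) ∂μ) x := by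
  have : ProperSpace E := FiniteDimensional.proper ℝ E
  have hK' : Continuous fun p => (fderiv ℝ K p).comp (ContinuousLinearMap.inl ℝ E H) :=
    (hK.continuous_fderiv (by simp)).clm_comp continuous_const
  obtain ⟨C, hC⟩ := ((isCompact_closedBall x 1).prod
    hS.isCompact_closure).exists_bound_of_continuousOn hK'.continuousOn
  have hslice : ∀ x : E, Continuous fun ξ : H => (x, ξ) := fun x => by fun_prop
  refine hasFDerivAt_integral_of_dominated_of_fderiv_le (s := Metric.closedBall x 1)
    (F' := fun x ξ => (fderiv ℝ K (x, ξ)).comp (ContinuousLinearMap.inl ℝ E H))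
    (bound := fun _ => C) (Metric.closedBall_mem_nhds x one_pos)
    (Eventually.of_forall fun y => ?_) ?_ ?_ ?_ (integrableOn_const hS.measure_lt_top.ne) ?_
  · exact (integrableOn_of_continuous_of_isBounded (hK.continuous.comp (hslice y)) hS).1
  · exact integrableOn_of_continuous_of_isBounded (hK.continuous.comp (hslice x)) hS
  · exact (integrableOn_of_continuous_of_isBounded (hK'.comp (hslice x)) hS).1
  · refine ae_restrict_of_ae_restrict_of_subset subset_closure ?_
    filter_upwards [ae_restrict_mem isClosed_closure.measurableSet] with ξ hξ y hy
    exact hC (y, ξ) ⟨hy, hξ⟩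
  · exact Eventually.of_forall fun ξ y _ =>
      (hK.differentiable (by simp) (y, ξ)).hasFDerivAt.comp y (hasFDerivAt_prodMk_left y ξ)

theorem fderiv_setIntegral_apply {K : E × H → F} (hK : ContDiff ℝ 1 K)
    (hS : Bornology.IsBounded S) (x v : E) :
    fderiv ℝ (fun x => ∫ ξ in S, K (x, ξ) ∂μ) x v = ∫ ξ in S, fderiv ℝ K (x, ξ) (v, 0) ∂μ := by
  have hcont : Continuous fun ξ => (fderiv ℝ K (x, ξ)).comp (ContinuousLinearMap.inl ℝ E H) :=
    ((hK.continuous_fderiv (by simp)).comp (by fun_prop)).clm_comp continuous_const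
  rw [(hasFDerivAt_setIntegral hK hS x).fderiv,
    ContinuousLinearMap.integral_apply (integrableOn_of_continuous_of_isBounded hcont hS)]
  rfl

theorem contDiff_setIntegral {K : E × H → F} (hK : ContDiff ℝ ∞ K) (hS : Bornology.IsBounded S) :
    ContDiff ℝ ∞ (fun x => ∫ ξ in S, K (x, ξ) ∂μ) := by
  refine contDiff_infty.2 fun k => ?_
  induction k generalizing K with
  | zero =>
    have hdiff : Differentiable ℝ (fun x => ∫ ξ in S, K (x, ξ) ∂μ) := fun x =>
      (hasFDerivAt_setIntegral (hK.of_le (by simp)) hS x).differentiableAt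
    exact contDiff_zero.2 hdiff.continuous
  | succ k ih =>
    have hK1 : ContDiff ℝ 1 K := hK.of_le (by simp)
    rw [Nat.cast_succ, contDiff_succ_iff_fderiv_apply]
    refine
      ⟨fun x => (hasFDerivAt_setIntegral (μ := μ) hK1 hS x).differentiableAt,
        fun h => absurd h (by simp), fun v => ?_⟩
    simp only [fderiv_setIntegral_apply hK1 hS]
    exact ih (K := fun p => fderiv ℝ K p (v, 0))
      ((hK.fderiv_right (by simp)).clm_apply contDiff_const)

end ParametricIntegral

section IndicatorConvolution

variable {S : Set (Pt m n)} {F : Pt m n → ℝ}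

/-- The convolution `1_S * F` on the group, `x ↦ ∫_S F(ξ⁻¹ ∘ x) dξ`. -/
def indicatorConv (G : HomogeneousLieGroup m n) (S : Set (Pt m n)) (F : Pt m n → ℝ) (x : Pt m n) :
    ℝ :=
  ∫ ξ in S, F (G.mul (G.inv ξ) x)

theorem contDiff_inv_mul (G : HomogeneousLieGroup m n) :
    ContDiff ℝ ∞ fun p : Pt m n × Pt m n => G.mul (G.inv p.1) p.2 :=
  G.contDiff_mul.comp ((G.contDiff_inv.comp contDiff_fst).prodMk contDiff_snd)

theorem integrableOn_comp_inv_mul (G : HomogeneousLieGroup m n) (hF : Continuous F)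
    (hS : Bornology.IsBounded S) (x : Pt m n) :
    IntegrableOn (fun ξ => F (G.mul (G.inv ξ) x)) S :=
  integrableOn_of_continuous_of_isBounded
    (hF.comp ((contDiff_inv_mul G).continuous.comp (Continuous.prodMk_left x))) hS

theorem contDiff_indicatorConv (G : HomogeneousLieGroup m n) (hF : ContDiff ℝ ∞ F)
    (hS : Bornology.IsBounded S) : ContDiff ℝ ∞ (indicatorConv G S F) :=
  contDiff_setIntegral (K := fun p => F (G.mul (G.inv p.2) p.1))
    (hF.comp ((contDiff_inv_mul G).comp (contDiff_snd.prodMk contDiff_fst))) hS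

theorem along_indicatorConv (G : HomogeneousLieGroup m n) (w : Pt m n) (hF : ContDiff ℝ ∞ F)
    (hS : Bornology.IsBounded S) :
    along G w (indicatorConv G S F) = indicatorConv G S (along G w F) := by
  funext x
  have hK : ContDiff ℝ ∞ fun p : Pt m n × Pt m n => F (G.mul (G.inv p.2) p.1) :=
    hF.comp ((contDiff_inv_mul G).comp (contDiff_snd.prodMk contDiff_fst))
  refine (fderiv_setIntegral_apply (hK.of_le (by simp)) hS x (leftInv G w x)).trans ?_
  refine integral_congr_ae (Eventually.of_forall fun ξ => ?_)
  have hslice : HasFDerivAt (fun x => F (G.mul (G.inv ξ) x)) _ x :=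
    (hK.differentiable (by simp) (x, ξ)).hasFDerivAt.comp (f := fun x => (x, ξ)) x
      (hasFDerivAt_prodMk_left x ξ)
  exact (along_eq hslice w).symm.trans
    (congrFun (along_comp_mul_left w (G.inv ξ) (hF.differentiable (by simp))) x)

theorem sum_along_along_indicatorConv (G : HomogeneousLieGroup m n) (X : Fin m → Pt m n)
    (A : Matrix (Fin m) (Fin m) ℝ) (hF : ContDiff ℝ ∞ F) (hS : Bornology.IsBounded S)
    (x : Pt m n) :
    ∑ i, ∑ j, A i j * along G (X i) (along G (X j) (indicatorConv G S F)) x =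
      indicatorConv G S (fun y => ∑ i, ∑ j, A i j * along G (X i) (along G (X j) F) y) x := by
  have hsmooth : ∀ i j, ContDiff ℝ ∞ (along G (X i) (along G (X j) F)) := fun i j =>
    contDiff_along G (X i) (contDiff_along G (X j) hF)
  have hint : ∀ i j, IntegrableOn
      (fun ξ => A i j * along G (X i) (along G (X j) F) (G.mul (G.inv ξ) x)) S := fun i j =>
    (integrableOn_comp_inv_mul G (hsmooth i j).continuous hS x).const_mul _
  rw [indicatorConv, integral_finsetSum _ fun i _ => integrable_finsetSum _ fun j _ => hint i j]
  refine Finset.sum_congr rfl fun i _ => ?_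
  rw [integral_finsetSum _ fun j _ => hint i j]
  refine Finset.sum_congr rfl fun j _ => ?_
  rw [integral_const_mul, along_indicatorConv G (X j) hF hS,
    along_indicatorConv G (X i) (contDiff_along G (X j) hF) hS, indicatorConv]

theorem comp_inv_mul_comm (hF : ∀ y, F (G.inv y) = F y) (x ξ : Pt m n) :
    F (G.mul (G.inv ξ) x) = F (G.mul (G.inv x) ξ) := by
  rw [← hF, inv_inv_mul]

theorem indicatorConv_add_compl (hF : Integrable F) (hFinv : ∀ y, F (G.inv y) = F y)
    (hS : MeasurableSet S) (x : Pt m n) :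
    indicatorConv G S F x + indicatorConv G Sᶜ F x = ∫ y, F y := by
  simp only [indicatorConv, comp_inv_mul_comm hFinv x]
  have hint : Integrable fun ξ => F (G.mul (G.inv x) ξ) :=
    (measurePreserving_mul_left G (G.inv x)).integrable_comp_of_integrable hF
  rw [integral_add_compl hS hint, integral_comp_mul_left]

end IndicatorConvolution

section Profiles

variable {α σ ε s : ℝ} {η : ℝ → ℝ}

theorem contDiff_of_eq_zero_of_lt {f : ℝ → ℝ} {a b : ℝ} (hab : a < b) (h0 : ∀ s < b, f s = 0)
    (h : ∀ s, a < s → ContDiffAt ℝ ∞ f s) : ContDiff ℝ ∞ f := by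
  refine contDiff_iff_contDiffAt.2 fun s => ?_
  rcases lt_or_ge s b with hs | hs
  · refine (contDiffAt_const (c := (0 : ℝ))).congr_of_eventuallyEq ?_
    filter_upwards [Iio_mem_nhds hs] with t ht using h0 t ht
  · exact h s (hab.trans_le hs)

/-- The radial profile of the truncated kernel in terms of the fourth power `s` of the gauge:
`η(d) d^{-α}` with `d = s^{1/4}`, extended by zero to `s ≤ 0`. -/
def cutProfile (α : ℝ) (η : ℝ → ℝ) (s : ℝ) : ℝ :=
  if s ≤ 0 then 0 else η (s ^ (1 / 4 : ℝ)) * s ^ (-(α / 4))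

theorem cutProfile_of_pos (α : ℝ) (η : ℝ → ℝ) (hs : 0 < s) :
    cutProfile α η s = η (s ^ (1 / 4 : ℝ)) * s ^ (-(α / 4)) :=
  if_neg hs.not_ge

theorem pow_four_rpow_one_div_four {r : ℝ} (hr : 0 ≤ r) : (r ^ 4) ^ (1 / 4 : ℝ) = r := by
  rw [one_div]
  exact_mod_cast Real.pow_rpow_inv_natCast hr four_ne_zero

theorem contDiff_cutProfile (hε : 0 < ε) (hη : IsCutoff ε η) : ContDiff ℝ ∞ (cutProfile α η) := by
  refine contDiff_of_eq_zero_of_lt (pow_pos hε 4) (fun s hs => ?_) fun s hs => ?_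
  · rcases le_or_gt s 0 with h | h
    · exact if_pos h
    · have hlt : s ^ (1 / 4 : ℝ) < ε := by
        simpa only [pow_four_rpow_one_div_four hε.le] using
          Real.rpow_lt_rpow h.le hs (by norm_num : (0 : ℝ) < 1 / 4)
      rw [cutProfile_of_pos α η h, hη.eq_zero _ (by positivity) hlt, zero_mul]
  · have hηs : ContDiffAt ℝ ∞ η (s ^ (1 / 4 : ℝ)) :=
      hη.smooth.contDiffAt (Ici_mem_nhds (by positivity))
    refine ((hηs.comp s (Real.contDiffAt_rpow_const_of_ne hs.ne')).mul
      (Real.contDiffAt_rpow_const_of_ne (p := -(α / 4)) hs.ne')).congr_of_eventuallyEq ?_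
    filter_upwards [Ioi_mem_nhds hs] with t ht using cutProfile_of_pos α η ht

theorem cutProfile_of_ge (hε : 0 < ε) (hη : IsCutoff ε η) (hs : (2 * ε) ^ 4 ≤ s) :
    cutProfile α η s = s ^ (-(α / 4)) := by
  have hge : 2 * ε ≤ s ^ (1 / 4 : ℝ) := by
    simpa only [pow_four_rpow_one_div_four (by positivity : 0 ≤ 2 * ε)] using
      Real.rpow_le_rpow (by positivity) hs (by norm_num : (0 : ℝ) ≤ 1 / 4)
  rw [cutProfile_of_pos α η (hs.trans_lt' (by positivity)), hη.eq_one _ hge, one_mul]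

/-- A smooth step from `0` to `1` over the interval `[σ, 2σ]`. -/
def smoothStep (σ s : ℝ) : ℝ := Real.smoothTransition ((s - σ) / σ)

theorem smoothStep_of_le (hσ : 0 < σ) (hs : s ≤ σ) : smoothStep σ s = 0 :=
  Real.smoothTransition.zero_of_nonpos (div_nonpos_of_nonpos_of_nonneg (by linarith) hσ.le)

theorem smoothStep_of_ge (hσ : 0 < σ) (hs : 2 * σ ≤ s) : smoothStep σ s = 1 :=
  Real.smoothTransition.one_of_one_le ((one_le_div hσ).2 (by linarith))

theorem smoothStep_le_one (σ s : ℝ) : smoothStep σ s ≤ 1 :=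
  Real.smoothTransition.le_one _

theorem monotone_smoothStep (hσ : 0 < σ) : Monotone (smoothStep σ) := fun s t hst =>
  Real.smoothTransition.monotone (by gcongr)

theorem contDiff_smoothStep (σ : ℝ) : ContDiff ℝ ∞ (smoothStep σ) :=
  Real.smoothTransition.contDiff.comp ((contDiff_id.sub contDiff_const).div_const σ)

theorem deriv_smoothStep_of_lt (hσ : 0 < σ) (hs : s < σ) : deriv (smoothStep σ) s = 0 := by
  have hev : smoothStep σ =ᶠ[𝓝 s] fun _ => 0 := by
    filter_upwards [Iio_mem_nhds hs] with t ht using smoothStep_of_le hσ (le_of_lt ht)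
  rw [hev.deriv_eq, deriv_const]

theorem deriv_smoothStep_of_gt (hσ : 0 < σ) (hs : 2 * σ < s) : deriv (smoothStep σ) s = 0 := by
  have hev : smoothStep σ =ᶠ[𝓝 s] fun _ => 1 := by
    filter_upwards [Ioi_mem_nhds hs] with t ht using smoothStep_of_ge hσ (le_of_lt ht)
  rw [hev.deriv_eq, deriv_const]

theorem exists_deriv_smoothStep_pos (hσ : 0 < σ) : ∃ s, σ < s ∧ 0 < deriv (smoothStep σ) s := by
  obtain ⟨s, hs, hslope⟩ := exists_deriv_eq_slope (smoothStep σ) (by linarith : σ < 2 * σ)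
    (contDiff_smoothStep σ).continuous.continuousOn
    ((contDiff_smoothStep σ).differentiable (by simp)).differentiableOn
  refine ⟨s, hs.1, ?_⟩
  rw [hslope, smoothStep_of_ge hσ le_rfl, smoothStep_of_le hσ le_rfl]
  have : 0 < 2 * σ - σ := by linarith
  positivity

/-- The part of the derivative of `-s^{-α/4}` cut off by `smoothStep σ`. -/
def tailDensity (α σ s : ℝ) : ℝ := α / 4 * s ^ (-(α / 4) - 1) * smoothStep σ s

theorem tailDensity_of_le (hσ : 0 < σ) (hs : s ≤ σ) : tailDensity α σ s = 0 := by
  rw [tailDensity, smoothStep_of_le hσ hs, mul_zero]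

theorem contDiff_tailDensity (α : ℝ) (hσ : 0 < σ) : ContDiff ℝ ∞ (tailDensity α σ) :=
  contDiff_of_eq_zero_of_lt hσ (fun _ hs => tailDensity_of_le hσ hs.le) fun _ hs =>
    (contDiffAt_const.mul (Real.contDiffAt_rpow_const_of_ne hs.ne')).mul
      (contDiff_smoothStep σ).contDiffAt

/-- The correction which makes `s^{-α/4}` constant for `s ≥ 2σ` without changing it for `s ≤ σ`. -/
def tailCorrection (α σ s : ℝ) : ℝ := ∫ t in σ..s, tailDensity α σ t

theorem hasDerivAt_tailCorrection (α : ℝ) (hσ : 0 < σ) (s : ℝ) :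
    HasDerivAt (tailCorrection α σ) (tailDensity α σ s) s :=
  ((contDiff_tailDensity α hσ).continuous.integral_hasStrictDerivAt σ s).hasDerivAt

theorem contDiff_tailCorrection (α : ℝ) (hσ : 0 < σ) : ContDiff ℝ ∞ (tailCorrection α σ) := by
  refine contDiff_infty_iff_deriv.2
    ⟨fun s => (hasDerivAt_tailCorrection α hσ s).differentiableAt, ?_⟩
  rw [funext fun s => (hasDerivAt_tailCorrection α hσ s).deriv]
  exact contDiff_tailDensity α hσ

theorem tailCorrection_of_le (α : ℝ) (hσ : 0 < σ) (hs : s ≤ σ) : tailCorrection α σ s = 0 := by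
  rw [tailCorrection, intervalIntegral.integral_congr (g := fun _ => 0),
    intervalIntegral.integral_zero]
  intro t ht
  rw [uIcc_of_ge hs] at ht
  exact tailDensity_of_le hσ ht.2

theorem hasDerivAt_rpow_neg (α : ℝ) (hs : 0 < s) :
    HasDerivAt (fun t : ℝ => t ^ (-(α / 4))) (-(α / 4) * s ^ (-(α / 4) - 1)) s :=
  Real.hasDerivAt_rpow_const (Or.inl hs.ne')

/-- The constant value of `s^{-α/4} + tailCorrection α σ s` for `s ≥ 2σ`. -/
def tailLimit (α σ : ℝ) : ℝ := (2 * σ) ^ (-(α / 4)) + tailCorrection α σ (2 * σ)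

theorem rpow_add_tailCorrection (α : ℝ) (hσ : 0 < σ) (hs : 2 * σ ≤ s) :
    s ^ (-(α / 4)) + tailCorrection α σ s = tailLimit α σ := by
  have hderiv : ∀ t ∈ Icc (2 * σ) s,
      HasDerivAt (fun t : ℝ => t ^ (-(α / 4)) + tailCorrection α σ t) 0 t := fun t ht => by
    refine ((hasDerivAt_rpow_neg α (by linarith [ht.1] : 0 < t)).fun_add
      (hasDerivAt_tailCorrection α hσ t)).congr_deriv ?_
    rw [tailDensity, smoothStep_of_ge hσ ht.1]
    ring
  exact constant_of_has_deriv_right_zero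
    (fun t ht => (hderiv t ht).continuousAt.continuousWithinAt)
    (fun t ht => (hderiv t ⟨ht.1, ht.2.le⟩).hasDerivWithinAt) s ⟨hs, le_rfl⟩

/-- The compactly supported modification of the truncated kernel, as a function of the fourth power
of the gauge. -/
def compactProfile (α σ : ℝ) (η : ℝ → ℝ) (s : ℝ) : ℝ :=
  cutProfile α η s + tailCorrection α σ s - tailLimit α σ

theorem contDiff_compactProfile (hσ : 0 < σ) (hε : 0 < ε) (hη : IsCutoff ε η) :
    ContDiff ℝ ∞ (compactProfile α σ η) :=
  ((contDiff_cutProfile hε hη).add (contDiff_tailCorrection α hσ)).sub contDiff_const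

theorem compactProfile_of_le (hσ : 0 < σ) (hs : s ≤ σ) :
    compactProfile α σ η s = cutProfile α η s - tailLimit α σ := by
  rw [compactProfile, tailCorrection_of_le α hσ hs, add_zero]

theorem compactProfile_of_ge (hσ : 0 < σ) (hε : 0 < ε) (hη : IsCutoff ε η)
    (hs : max (2 * σ) ((2 * ε) ^ 4) ≤ s) : compactProfile α σ η s = 0 := by
  rw [compactProfile, cutProfile_of_ge hε hη ((le_max_right _ _).trans hs),
    rpow_add_tailCorrection α hσ ((le_max_left _ _).trans hs), sub_self]

theorem deriv_compactProfile (hσ : 0 < σ) (hε : 0 < ε) (hη : IsCutoff ε η)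
    (hs : (2 * ε) ^ 4 < s) :
    deriv (compactProfile α σ η) s = -(α / 4) * s ^ (-(α / 4) - 1) * (1 - smoothStep σ s) := by
  have hcut : HasDerivAt (cutProfile α η) (-(α / 4) * s ^ (-(α / 4) - 1)) s := by
    refine (hasDerivAt_rpow_neg α (hs.trans' (by positivity))).congr_of_eventuallyEq ?_
    filter_upwards [Ioi_mem_nhds hs] with t ht using cutProfile_of_ge hε hη (le_of_lt ht)
  have hcompact : HasDerivAt (compactProfile α σ η) _ s :=
    (hcut.fun_add (hasDerivAt_tailCorrection α hσ s)).sub_const (tailLimit α σ)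
  rw [hcompact.deriv, tailDensity]
  ring

theorem deriv_deriv_compactProfile (hσ : 0 < σ) (hε : 0 < ε) (hη : IsCutoff ε η)
    (hs : (2 * ε) ^ 4 < s) :
    deriv (deriv (compactProfile α σ η)) s = α / 4 * s ^ (-(α / 4) - 1) *
      ((α / 4 + 1) / s * (1 - smoothStep σ s) + deriv (smoothStep σ) s) := by
  have hs0 : 0 < s := hs.trans' (by positivity)
  have hev : deriv (compactProfile α σ η) =ᶠ[𝓝 s]
      fun s => -(α / 4) * s ^ (-(α / 4) - 1) * (1 - smoothStep σ s) := by
    filter_upwards [Ioi_mem_nhds hs] with t ht using deriv_compactProfile hσ hε hη ht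
  have hrpow : HasDerivAt (fun t : ℝ => t ^ (-(α / 4) - 1))
      ((-(α / 4) - 1) * s ^ (-(α / 4) - 1 - 1)) s := Real.hasDerivAt_rpow_const (Or.inl hs0.ne')
  have hstep := ((contDiff_smoothStep σ).differentiable (by simp) s).hasDerivAt
  rw [hev.deriv_eq, ((hrpow.const_mul (-(α / 4))).fun_mul (hstep.const_sub 1)).deriv,
    Real.rpow_sub_one hs0.ne' (-(α / 4) - 1)]
  field_simp
  ring

end Profiles

section TruncatedBarrier

variable {α σ ε : ℝ} {η : ℝ → ℝ} {O S : Set (Pt m n)}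

theorem isBounded_gaugeBall (hG : IsHType G g) (hX : IsHorizontalBasis G g X) (r : ℝ) :
    Bornology.IsBounded (gaugeBall G g X r) :=
  (isCompact_gaugePow_le hG hX (r ^ 4)).isBounded.subset fun x hx => by
    rw [mem_ofPred_eq, gaugePow_eq_gaugeNorm_pow hG hX]
    exact pow_le_pow_left₀ (gaugeNorm_nonneg hG hX x) (le_of_lt hx) 4

theorem cutKernel_eq (hG : IsHType G g) (hX : IsHorizontalBasis G g X) (hα : 0 < α)
    (η : ℝ → ℝ) (x ξ : Pt m n) :
    cutKernel G g X α η x ξ = cutProfile α η (gaugePow G g X (G.mul (G.inv ξ) x)) := by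
  rw [cutKernel, kernel_eq hG hX, gaugeNorm_eq hG hX, gaugePow_inv_mul_comm hG hX x]
  rcases (gaugePow_nonneg hG (G.mul (G.inv ξ) x) (X := X)).eq_or_lt with h | h
  · rw [← h, cutProfile, if_pos le_rfl, Real.zero_rpow (x := -(α / 4)) (by linarith), mul_zero]
  · rw [cutProfile_of_pos α η h]

theorem cutBarrier_eq (hG : IsHType G g) (hX : IsHorizontalBasis G g X) (hα : 0 < α)
    (η : ℝ → ℝ) (O : Set (Pt m n)) :
    cutBarrier G g X α η O =
      fun x => -(1 / α) * indicatorConv G O (fun y => cutProfile α η (gaugePow G g X y)) x := by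
  funext x
  simp only [cutBarrier, indicatorConv, cutKernel_eq hG hX hα]

theorem contDiff_cutBarrier (hG : IsHType G g) (hX : IsHorizontalBasis G g X) (hα : 0 < α)
    (hε : 0 < ε) (hη : IsCutoff ε η) (hO : Bornology.IsBounded O) :
    ContDiff ℝ ∞ (cutBarrier G g X α η O) := by
  rw [cutBarrier_eq hG hX hα]
  exact contDiff_const.mul (contDiff_indicatorConv G
    ((contDiff_cutProfile hε hη).comp (contDiff_gaugePow hG hX)) hO)

theorem exists_gaugePow_inv_mul_lt (hG : IsHType G g) (hX : IsHorizontalBasis G g X)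
    (hS : Bornology.IsBounded S) :
    ∃ σ : ℝ, 0 < σ ∧ ∀ x ∈ S, ∀ ξ ∈ S, gaugePow G g X (G.mul (G.inv ξ) x) < σ := by
  have hcont : Continuous fun p : Pt m n × Pt m n => gaugePow G g X (G.mul (G.inv p.1) p.2) :=
    (continuous_gaugePow hG hX).comp (contDiff_inv_mul G).continuous
  obtain ⟨C, hC⟩ := (hS.isCompact_closure.prod
    hS.isCompact_closure).exists_bound_of_continuousOn hcont.continuousOn
  refine ⟨max C 0 + 1, by positivity, fun x hx ξ hξ => ?_⟩
  have hbound := hC (ξ, x) ⟨subset_closure hξ, subset_closure hx⟩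
  linarith [Real.le_norm_self (gaugePow G g X (G.mul (G.inv ξ) x)), le_max_left C 0]

theorem exists_isCompact_lt_gaugePow_inv_mul (hG : IsHType G g) (hX : IsHorizontalBasis G g X)
    (hS : Bornology.IsBounded S) (c : ℝ) :
    ∃ T, IsCompact T ∧ ∀ x ∈ S, ∀ ξ ∉ T, c < gaugePow G g X (G.mul (G.inv ξ) x) := by
  refine ⟨_, (hS.isCompact_closure.prod (isCompact_gaugePow_le hG hX c)).image
    G.contDiff_mul.continuous, fun x hx ξ hξ => ?_⟩
  by_contra hle
  rw [not_lt, gaugePow_inv_mul_comm hG hX] at hle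
  exact hξ ⟨(x, G.mul (G.inv x) ξ), ⟨subset_closure hx, hle⟩, mul_mul_inv_mul G x ξ⟩

theorem integrable_compactProfile_gaugePow (hG : IsHType G g) (hX : IsHorizontalBasis G g X)
    (hσ : 0 < σ) (hε : 0 < ε) (hη : IsCutoff ε η) :
    Integrable fun y => compactProfile α σ η (gaugePow G g X y) :=
  ((contDiff_compactProfile hσ hε hη).continuous.comp
    (continuous_gaugePow hG hX)).integrable_of_hasCompactSupport
    (HasCompactSupport.intro (isCompact_gaugePow_le hG hX (max (2 * σ) ((2 * ε) ^ 4)))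
      fun _ hz => compactProfile_of_ge hσ hε hη (le_of_lt (not_le.1 hz)))

theorem indicatorConv_cutProfile_gaugePow (hG : IsHType G g) (hX : IsHorizontalBasis G g X)
    (hσ : 0 < σ) (hε : 0 < ε) (hη : IsCutoff ε η) (hO : MeasurableSet O)
    (hOb : Bornology.IsBounded O) {x : Pt m n}
    (hnear : ∀ ξ ∈ O, gaugePow G g X (G.mul (G.inv ξ) x) < σ) :
    indicatorConv G O (fun y => cutProfile α η (gaugePow G g X y)) x =
      indicatorConv G O (fun y => compactProfile α σ η (gaugePow G g X y)) x +
        volume.real O * tailLimit α σ := by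
  have hcont : Continuous fun y => compactProfile α σ η (gaugePow G g X y) :=
    (contDiff_compactProfile hσ hε hη).continuous.comp (continuous_gaugePow hG hX)
  rw [indicatorConv, indicatorConv, ← smul_eq_mul (volume.real O), ← setIntegral_const,
    ← integral_add (integrableOn_comp_inv_mul G hcont hOb x)
      (integrableOn_const hOb.measure_lt_top.ne)]
  refine setIntegral_congr_fun hO fun ξ hξ => ?_
  simp only [compactProfile_of_le hσ (hnear ξ hξ).le, sub_add_cancel]

/-- On `O` the kernel may be corrected beyond `N = σ` at the cost of a constant, and the integral of
the corrected kernel over the whole group does not depend on `x`. -/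
theorem cutBarrier_eq_add_const (hG : IsHType G g) (hX : IsHorizontalBasis G g X) (hα : 0 < α)
    (hσ : 0 < σ) (hε : 0 < ε) (hη : IsCutoff ε η) (hO : MeasurableSet O)
    (hOb : Bornology.IsBounded O)
    (hnear : ∀ x ∈ O, ∀ ξ ∈ O, gaugePow G g X (G.mul (G.inv ξ) x) < σ) {T : Set (Pt m n)}
    (hfar : ∀ x ∈ O, ∀ ξ ∉ T, max (2 * σ) ((2 * ε) ^ 4) < gaugePow G g X (G.mul (G.inv ξ) x)) :
    ∃ d : ℝ, ∀ x ∈ O, cutBarrier G g X α η O x =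
      1 / α * indicatorConv G (T \ O) (fun y => compactProfile α σ η (gaugePow G g X y)) x + d := by
  set Φ : Pt m n → ℝ := fun y => compactProfile α σ η (gaugePow G g X y)
  refine ⟨-(1 / α) * ((∫ y, Φ y) + volume.real O * tailLimit α σ), fun x hx => ?_⟩
  have hcompl : indicatorConv G Oᶜ Φ x = indicatorConv G (T \ O) Φ x :=
    setIntegral_eq_of_subset_of_forall_sdiff_eq_zero hO.compl (fun ξ hξ => hξ.2) fun ξ hξ =>
      compactProfile_of_ge hσ hε hη (hfar x hx ξ fun hT => hξ.2 ⟨hT, hξ.1⟩).le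
  have hsum : indicatorConv G O Φ x + indicatorConv G (T \ O) Φ x = ∫ y, Φ y := by
    rw [← hcompl]
    exact indicatorConv_add_compl (integrable_compactProfile_gaugePow hG hX hσ hε hη)
      (fun y => by simp only [gaugePow_inv hG hX]) hO x
  simp only [cutBarrier_eq hG hX hα, ← hsum,
    indicatorConv_cutProfile_gaugePow hG hX hσ hε hη hO hOb (hnear x hx)]
  ring

theorem along_congr (hO : IsOpen O) {f h : Pt m n → ℝ} {c d : ℝ} (hh : Differentiable ℝ h)
    (hfh : ∀ y ∈ O, f y = c * h y + d) (w : Pt m n) {x : Pt m n} (hx : x ∈ O) :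
    along G w f x = c * along G w h x := by
  have hder : HasFDerivAt f (c • fderiv ℝ h x) x :=
    (((hh x).hasFDerivAt.const_mul c).add_const d).congr_of_eventuallyEq
      (eventually_of_mem (hO.mem_nhds hx) hfh)
  exact along_eq hder w

theorem along_along_congr (hO : IsOpen O) {f h : Pt m n → ℝ} {c d : ℝ} (hh : ContDiff ℝ ∞ h)
    (hfh : ∀ y ∈ O, f y = c * h y + d) (v w : Pt m n) {x : Pt m n} (hx : x ∈ O) :
    along G v (along G w f) x = c * along G v (along G w h) x :=
  along_congr (d := 0) hO ((contDiff_along G w hh).differentiable (by simp))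
    (fun y hy => by rw [along_congr hO (hh.differentiable (by simp)) hfh w hy, add_zero]) v hx

theorem opL_cutBarrier_eq (hG : IsHType G g) (hX : IsHorizontalBasis G g X) (hα : 0 < α)
    (hσ : 0 < σ) (hε : 0 < ε) (hη : IsCutoff ε η) (hO : IsOpen O)
    (hOb : Bornology.IsBounded O)
    (hnear : ∀ x ∈ O, ∀ ξ ∈ O, gaugePow G g X (G.mul (G.inv ξ) x) < σ) {T : Set (Pt m n)}
    (hT : Bornology.IsBounded T)
    (hfar : ∀ x ∈ O, ∀ ξ ∉ T, max (2 * σ) ((2 * ε) ^ 4) < gaugePow G g X (G.mul (G.inv ξ) x))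
    (A : Pt m n → Matrix (Fin m) (Fin m) ℝ) {x : Pt m n} (hx : x ∈ O) :
    opL G X A (cutBarrier G g X α η O) x = 1 / α * indicatorConv G (T \ O) (fun y =>
      ∑ i, ∑ j, A x i j *
        along G (X i) (along G (X j) fun y => compactProfile α σ η (gaugePow G g X y)) y) x := by
  have hΦ : ContDiff ℝ ∞ fun y => compactProfile α σ η (gaugePow G g X y) :=
    (contDiff_compactProfile hσ hε hη).comp (contDiff_gaugePow hG hX)
  have hTO : Bornology.IsBounded (T \ O) := hT.subset sdiff_subset
  obtain ⟨d, hd⟩ :=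
    cutBarrier_eq_add_const hG hX hα hσ hε hη hO.measurableSet hOb hnear hfar
  rw [← sum_along_along_indicatorConv G X (A x) hΦ hTO x, opL]
  simp only [Finset.mul_sum, along_along_congr hO (contDiff_indicatorConv G hΦ hTO) hd _ _ hx]
  exact Finset.sum_congr rfl fun i _ => Finset.sum_congr rfl fun j _ => mul_left_comm _ _ _

end TruncatedBarrier

section LowerBound

variable {α σ ε δ lam Lam : ℝ} {η : ℝ → ℝ} {O O' T : Set (Pt m n)}

/-- The density `4 |v|² N^{-α/4} χ'(N)`, where `N` is the fourth power of the gauge and `χ` is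
`smoothStep σ`. Up to the factor `α λ` it bounds `L_A` of the compactly supported kernel from
below, away from the truncated singularity. -/
def lowerDensity (G : HomogeneousLieGroup m n) (g : LinearMap.BilinForm ℝ (Pt m n))
    (X : Fin m → Pt m n) (α σ : ℝ) (y : Pt m n) : ℝ :=
  4 * horSq g X y * (gaugePow G g X y ^ (-(α / 4)) * deriv (smoothStep σ) (gaugePow G g X y))

theorem lowerDensity_nonneg (hG : IsHType G g) (hσ : 0 < σ) (y : Pt m n) :
    0 ≤ lowerDensity G g X α σ y :=
  mul_nonneg (mul_nonneg (by norm_num) (horSq_nonneg y))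
    (mul_nonneg (Real.rpow_nonneg (gaugePow_nonneg hG y) _) (monotone_smoothStep hσ).deriv_nonneg)

theorem continuous_lowerDensity (hG : IsHType G g) (hX : IsHorizontalBasis G g X) (hσ : 0 < σ) :
    Continuous (lowerDensity G g X α σ) := by
  have hprofile : ContDiff ℝ ∞ fun s : ℝ => s ^ (-(α / 4)) * deriv (smoothStep σ) s :=
    contDiff_of_eq_zero_of_lt hσ
      (fun s hs => by rw [deriv_smoothStep_of_lt hσ hs, mul_zero]) fun s hs =>
      (Real.contDiffAt_rpow_const_of_ne hs.ne').mul
        (contDiff_infty_iff_deriv.1 (contDiff_smoothStep σ)).2.contDiffAt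
  exact (continuous_const.mul (contDiff_horSq g X (k := 0)).continuous).mul
    (hprofile.continuous.comp (continuous_gaugePow hG hX))

theorem lowerDensity_of_lt (hσ : 0 < σ) {y : Pt m n} (hy : gaugePow G g X y < σ) :
    lowerDensity G g X α σ y = 0 := by
  rw [lowerDensity, deriv_smoothStep_of_lt hσ hy, mul_zero, mul_zero]

theorem lowerDensity_of_gt (hσ : 0 < σ) {y : Pt m n} (hy : 2 * σ < gaugePow G g X y) :
    lowerDensity G g X α σ y = 0 := by
  rw [lowerDensity, deriv_smoothStep_of_gt hσ hy, mul_zero, mul_zero]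

theorem lowerDensity_inv (hG : IsHType G g) (hX : IsHorizontalBasis G g X) (y : Pt m n) :
    lowerDensity G g X α σ (G.inv y) = lowerDensity G g X α σ y := by
  rw [lowerDensity, lowerDensity, horSq_inv hG hX, gaugePow_inv hG hX]

theorem integral_lowerDensity_pos (hG : IsHType G g) (hX : IsHorizontalBasis G g X) (hm : 0 < m)
    (hσ : 0 < σ) : 0 < ∫ y, lowerDensity G g X α σ y := by
  obtain ⟨s, hs, hderiv⟩ := exists_deriv_smoothStep_pos hσ
  have hs0 : 0 < s := hσ.trans hs
  obtain ⟨y, hy, hhor⟩ := exists_gaugePow_eq hG hX hm hs0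
  refine (continuous_lowerDensity hG hX hσ).integral_pos_of_hasCompactSupport_nonneg_nonzero
    (x := y) (HasCompactSupport.intro (isCompact_gaugePow_le hG hX (2 * σ)) fun z hz =>
      lowerDensity_of_gt hσ (not_le.1 hz)) (lowerDensity_nonneg hG hσ) ?_
  rw [lowerDensity, hy]
  positivity

theorem indicatorConv_lowerDensity (hG : IsHType G g) (hX : IsHorizontalBasis G g X) (hσ : 0 < σ)
    {x : Pt m n} (hnear : ∀ ξ ∈ O, gaugePow G g X (G.mul (G.inv ξ) x) < σ)
    (hfar : ∀ ξ ∉ T, 2 * σ < gaugePow G g X (G.mul (G.inv ξ) x)) :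
    indicatorConv G (T \ O) (lowerDensity G g X α σ) x = ∫ y, lowerDensity G g X α σ y := by
  rw [← integral_comp_mul_left G (G.inv x) (lowerDensity G g X α σ), indicatorConv,
    setIntegral_eq_integral_of_forall_compl_eq_zero fun ξ hξ => ?_]
  · simp only [comp_inv_mul_comm (lowerDensity_inv hG hX) x]
  · by_cases hξO : ξ ∈ O
    · exact lowerDensity_of_lt hσ (hnear ξ hξO)
    · exact lowerDensity_of_gt hσ (hfar ξ fun hξT => hξ ⟨hξT, hξO⟩)

theorem sum_mul_gaugeHess_le_div (hG : IsHType G g) (hX : IsHorizontalBasis G g X) (hα : 0 < α)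
    (hαδ : α = homDim m n - δ) {A : Matrix (Fin m) (Fin m) ℝ} (hA : IsElliptic lam Lam A)
    (hL : Landis n δ A) {y : Pt m n} (hy : 0 < gaugePow G g X y) :
    ∑ i, ∑ j, A i j * gaugeHess G g X y i j ≤
      (α / 4 + 1) / gaugePow G g X y * ((A *ᵥ gaugeGrad G g X y) ⬝ᵥ gaugeGrad G g X y) := by
  have hlandis := landis_bound hG hX (by linarith) hA hL y
  rw [show homDim m n + 4 - δ = α + 4 by rw [hαδ]; ring] at hlandis
  rw [div_mul_eq_mul_div, le_div_iff₀ hy]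
  linarith

theorem mul_lowerDensity_le (hG : IsHType G g) (hX : IsHorizontalBasis G g X) (hα : 0 < α)
    (hαδ : α = homDim m n - δ) (hσ : 0 < σ) (hε : 0 < ε) (hη : IsCutoff ε η)
    {A : Matrix (Fin m) (Fin m) ℝ} (hA : IsElliptic lam Lam A) (hL : Landis n δ A) {y : Pt m n}
    (hy : (2 * ε) ^ 4 < gaugePow G g X y) :
    α * lam * lowerDensity G g X α σ y ≤ ∑ i, ∑ j, A i j *
      along G (X i) (along G (X j) fun y => compactProfile α σ η (gaugePow G g X y)) y := by
  have hpow : 0 < gaugePow G g X y := hy.trans' (by positivity)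
  have hhess := sum_mul_gaugeHess_le_div hG hX hα hαδ hA hL hpow
  have hgrad := (hA.2 (gaugeGrad G g X y)).1
  rw [gaugeGrad_dotProduct_self hG hX] at hgrad
  have hsmooth : ContDiff ℝ 2 (compactProfile α σ η) :=
    mod_cast contDiff_infty.1 (contDiff_compactProfile hσ hε hη) 2
  rw [sum_along_along_comp_gaugePow hG hX hsmooth,
    deriv_compactProfile hσ hε hη hy, deriv_deriv_compactProfile hσ hε hη hy, lowerDensity,
    show gaugePow G g X y ^ (-(α / 4)) = gaugePow G g X y ^ (-(α / 4) - 1) * gaugePow G g X y by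
      rw [Real.rpow_sub_one hpow.ne', div_mul_cancel₀ _ hpow.ne']]
  have hrpow : 0 < gaugePow G g X y ^ (-(α / 4) - 1) := Real.rpow_pos_of_pos hpow _
  have hstep' : 0 ≤ deriv (smoothStep σ) (gaugePow G g X y) := (monotone_smoothStep hσ).deriv_nonneg
  have hstep : 0 ≤ 1 - smoothStep σ (gaugePow G g X y) := sub_nonneg.2 (smoothStep_le_one _ _)
  set N := gaugePow G g X y
  set p := N ^ (-(α / 4) - 1)
  set χ := smoothStep σ N
  set χ' := deriv (smoothStep σ) N
  set E := (A *ᵥ gaugeGrad G g X y) ⬝ᵥ gaugeGrad G g X y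
  set H := ∑ i, ∑ j, A i j * gaugeHess G g X y i j
  calc α * lam * (4 * horSq g X y * (p * N * χ'))
      = α / 4 * p * χ' * (lam * (16 * horSq g X y * N)) := by ring
    _ ≤ α / 4 * p * χ' * E := by gcongr
    _ ≤ α / 4 * p * χ' * E + α / 4 * p * (1 - χ) * ((α / 4 + 1) / N * E - H) :=
      le_add_of_nonneg_right (mul_nonneg (by positivity) (sub_nonneg.2 hhess))
    _ = α / 4 * p * ((α / 4 + 1) / N * (1 - χ) + χ') * E + -(α / 4) * p * (1 - χ) * H := by ring

theorem lt_gaugePow_of_lt_gaugeDist (hG : IsHType G g) (hX : IsHorizontalBasis G g X) {c : ℝ}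
    (hc : 0 ≤ c) (hO' : O' ⊆ O) (hdist : c < gaugeDist G g X O' (frontier O)) {x ξ : Pt m n}
    (hx : x ∈ O') (hξ : ξ ∉ O) : c ^ 4 < gaugePow G g X (G.mul (G.inv ξ) x) := by
  by_contra hle
  rw [not_lt, ← gaugePow_inv_mul_comm hG hX, gaugePow_eq_gaugeNorm_pow hG hX,
    pow_le_pow_iff_left₀ (gaugeNorm_nonneg hG hX _) hc four_ne_zero] at hle
  have hmem := mul_mem_of_lt_gaugeDist hG hX hO' hx (hle.trans_lt hdist)
  exact hξ (mul_mul_inv_mul G x ξ ▸ hmem)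

theorem le_opL_cutBarrier (hG : IsHType G g) (hX : IsHorizontalBasis G g X) (hα : 0 < α)
    (hαδ : α = homDim m n - δ) (hσ : 0 < σ) (hε : 0 < ε) (hη : IsCutoff ε η) (hO : IsOpen O)
    (hOb : Bornology.IsBounded O)
    (hnear : ∀ x ∈ O, ∀ ξ ∈ O, gaugePow G g X (G.mul (G.inv ξ) x) < σ) (hO' : O' ⊆ O)
    (hdist : 2 * ε < gaugeDist G g X O' (frontier O))
    {A : Pt m n → Matrix (Fin m) (Fin m) ℝ} {x : Pt m n} (hx : x ∈ O')
    (hA : IsElliptic lam Lam (A x)) (hL : Landis n δ (A x)) :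
    (∫ y, lowerDensity G g X α σ y) * lam ≤ opL G X A (cutBarrier G g X α η O) x := by
  obtain ⟨T, hT, hfar⟩ :=
    exists_isCompact_lt_gaugePow_inv_mul hG hX hOb (max (2 * σ) ((2 * ε) ^ 4))
  have hTO : Bornology.IsBounded (T \ O) := hT.isBounded.subset sdiff_subset
  have hΦ : ContDiff ℝ ∞ fun y => compactProfile α σ η (gaugePow G g X y) :=
    (contDiff_compactProfile hσ hε hη).comp (contDiff_gaugePow hG hX)
  set LΦ : Pt m n → ℝ := fun y => ∑ i, ∑ j, A x i j *
    along G (X i) (along G (X j) fun y => compactProfile α σ η (gaugePow G g X y)) y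
  have hLΦc : Continuous LΦ := (ContDiff.sum fun i _ => ContDiff.sum fun j _ => contDiff_const.mul
    (contDiff_along G (X i) (contDiff_along G (X j) hΦ)) : ContDiff ℝ ∞ LΦ).continuous
  have hmono : α * lam * indicatorConv G (T \ O) (lowerDensity G g X α σ) x ≤
      indicatorConv G (T \ O) LΦ x := by
    rw [indicatorConv, ← integral_const_mul]
    exact setIntegral_mono_on
      ((integrableOn_comp_inv_mul G (continuous_lowerDensity hG hX hσ) hTO x).const_mul _)
      (integrableOn_comp_inv_mul G hLΦc hTO x)
      (hT.measurableSet.diff hO.measurableSet) fun ξ hξ =>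
      mul_lowerDensity_le hG hX hα hαδ hσ hε hη hA hL
        (lt_gaugePow_of_lt_gaugeDist hG hX (by positivity) hO' hdist hx hξ.2)
  rw [indicatorConv_lowerDensity hG hX hσ (hnear x (hO' hx)) fun ξ hξ =>
    (le_max_left _ _).trans_lt (hfar x (hO' hx) ξ hξ)] at hmono
  rw [opL_cutBarrier_eq hG hX hα hσ hε hη hO hOb hnear hT.isBounded hfar A (hO' hx)]
  calc (∫ y, lowerDensity G g X α σ y) * lam
      = 1 / α * (α * lam * ∫ y, lowerDensity G g X α σ y) := by field_simp
    _ ≤ 1 / α * indicatorConv G (T \ O) LΦ x := by gcongr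

end LowerBound

theorem two_lt_homDim (hm : 0 < m) (hn : 0 < n) : 2 < homDim m n := by
  have hm' : (1 : ℝ) ≤ m := mod_cast hm
  have hn' : (1 : ℝ) ≤ n := mod_cast hn
  rw [homDim]
  linarith

end HType

end

theorem lemma3p1_general {m n : ℕ} (hn : 0 < n)
    (G : HType.HomogeneousLieGroup m n) (g : LinearMap.BilinForm ℝ (HType.Pt m n))
    (hG : HType.IsHType G g)
    (X : Fin m → HType.Pt m n) (hX : HType.IsHorizontalBasis G g X)
    (δ α : ℝ) (hδ : 0 < δ) (hδQ : δ < HType.homDim m n) (hα : α = HType.homDim m n - δ) :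
    ∃ C : ℝ, 0 < C ∧
      ∀ O : Set (HType.Pt m n), IsOpen O → O ⊆ HType.gaugeBall G g X 1 →
        (∀ x, IntegrableOn (HType.kernel G g X α x) O) ∧
        (∀ ε : ℝ, 0 < ε → ∀ η : ℝ → ℝ, HType.IsCutoff ε η →
          (∀ x, IntegrableOn (HType.cutKernel G g X α η x) O) ∧
          ContDiff ℝ ∞ (HType.cutBarrier G g X α η O)) ∧
        (∀ η : ℝ → ℝ → ℝ, (∀ ε, 0 < ε → HType.IsCutoff ε (η ε)) →
          TendstoUniformly (fun ε => HType.cutBarrier G g X α (η ε) O)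
            (HType.barrier G g X α O) (𝓝[>] 0)) ∧
        ∀ (lam Lam : ℝ) (Ω : Set (HType.Pt m n))
          (A : HType.Pt m n → Matrix (Fin m) (Fin m) ℝ),
            (∀ x ∈ Ω, HType.IsElliptic lam Lam (A x)) → (∀ x ∈ Ω, HType.Landis n δ (A x)) →
            ∀ O' : Set (HType.Pt m n), O' ⊆ O → O' ⊆ Ω →
              ∀ ε : ℝ, 0 < ε → 2 * ε < HType.gaugeDist G g X O' (frontier O) →
                ∀ η : ℝ → ℝ, HType.IsCutoff ε η →
                  ∀ x ∈ O', C * lam ≤ HType.opL G X A (HType.cutBarrier G g X α η O) x := by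
  have hα0 : 0 < α := by linarith
  have hαQ : α < HType.homDim m n := by linarith
  have hball := HType.isBounded_gaugeBall hG hX 1
  obtain ⟨σ, hσ, hnear⟩ := HType.exists_gaugePow_inv_mul_lt hG hX hball
  refine ⟨∫ y, HType.lowerDensity G g X α σ y,
    HType.integral_lowerDensity_pos hG hX (hG.horizontal_dim_pos hn) hσ, fun O hO hOB => ?_⟩
  have hOb : Bornology.IsBounded O := hball.subset hOB
  have hvol : volume O ≠ ⊤ := hOb.measure_lt_top.ne
  refine ⟨HType.integrableOn_kernel hG hX hα0 hαQ hvol,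
    fun ε hε η hη => ⟨HType.integrableOn_cutKernel hG hX hα0 hαQ hvol hη,
      HType.contDiff_cutBarrier hG hX hα0 hε hη hOb⟩,
    fun η hη => HType.tendstoUniformly_cutBarrier hG hX hα0 hαQ hvol hη, ?_⟩
  intro lam Lam Ω A hell hlandis O' hO'O hO'Ω ε hε hdist η hη x hx
  exact HType.le_opL_cutBarrier hG hX hα0 hα hσ hε hη hO hOb
    (fun x hx ξ hξ => hnear x (hOB hx) ξ (hOB hξ)) hO'O hdist hx
    (hell x (hO'Ω hx)) (hlandis x (hO'Ω hx))

theorem lemma3p1 {m n : ℕ} (hn : 0 < n)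
    (G : HType.HomogeneousLieGroup m n) (g : LinearMap.BilinForm ℝ (HType.Pt m n))
    (hG : HType.IsHType G g)
    (X : Fin m → HType.Pt m n) (hX : HType.IsHorizontalBasis G g X)
    (δ α : ℝ) (hδ : 0 < δ) (hδ2 : δ ≤ 2) (hα : α = HType.homDim m n - δ) :
    ∃ C : ℝ, 0 < C ∧
      ∀ O : Set (HType.Pt m n), IsOpen O → O ⊆ HType.gaugeBall G g X 1 →
        (∀ x, IntegrableOn (HType.kernel G g X α x) O) ∧
        (∀ ε : ℝ, 0 < ε → ∀ η : ℝ → ℝ, HType.IsCutoff ε η →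
          (∀ x, IntegrableOn (HType.cutKernel G g X α η x) O) ∧
          ContDiff ℝ ∞ (HType.cutBarrier G g X α η O)) ∧
        (∀ η : ℝ → ℝ → ℝ, (∀ ε, 0 < ε → HType.IsCutoff ε (η ε)) →
          TendstoUniformly (fun ε => HType.cutBarrier G g X α (η ε) O)
            (HType.barrier G g X α O) (𝓝[>] 0)) ∧
        ∀ lam Lam : ℝ, 0 < lam → lam ≤ Lam →
          ∀ (Ω : Set (HType.Pt m n)) (A : HType.Pt m n → Matrix (Fin m) (Fin m) ℝ), IsOpen Ω →
            (∀ x ∈ Ω, HType.IsElliptic lam Lam (A x)) → (∀ x ∈ Ω, HType.Landis n δ (A x)) →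
            ∀ O' : Set (HType.Pt m n), IsCompact O' → O' ⊆ O → O' ⊆ Ω →
              ∀ ε : ℝ, 0 < ε → 2 * ε < HType.gaugeDist G g X O' (frontier O) →
                ∀ η : ℝ → ℝ, HType.IsCutoff ε η →
                  ∀ x ∈ O', C * lam ≤ HType.opL G X A (HType.cutBarrier G g X α η O) x := by
  obtain ⟨C, hC, h⟩ := lemma3p1_general hn G g hG X hX δ α hδ
    (hδ2.trans_lt (HType.two_lt_homDim (hG.horizontal_dim_pos hn) hn)) hα
  exact ⟨C, hC, fun O hO hOB => (h O hO hOB).imp_right <| And.imp_right <| And.imp_right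
    fun h lam Lam _ _ Ω A _ hell hlandis O' _ => h lam Lam Ω A hell hlandis O'⟩
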